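/- Fix a prime $p$. Let $\mathbb Z[\frac1p]=\{a/p^k: a\in\mathbb Z,\ k\in\mathbb N\}\subset\mathbb Q$, $\Gamma=\mathbb Z[\frac1p]\times\mathbb Z[\frac1p]$ and $\Gamma_j=p^{-j}\mathbb Z\times p^{-j}\mathbb Z\subset\Gamma$ for $j\in\mathbb N$. Let $\Omega_p$ be the set of sequences $\theta=(\theta_n)_{n\ge 0}$ in $[0,1)$ with $p\,\theta_{n+1}\equiv\theta_n \pmod{\mathbb Z}$ for all $n$, and fix $\theta\in\Omega_p$. *Algebras.* For a discrete group $G$ with multiplier ($\mathbb T$-valued 2-cocycle) $\sigma$, $C^*(G,\sigma)$ is the full twisted group $C^*$-algebra, with canonical unitaries $\delta_g$, $\delta_g\delta_h=\sigma(g,h)\delta_{gh}$; $C_C(G,\sigma)$ is its $*$-subalgebra of finitely supported functions, and $\lambda_\sigma$ its left $\sigma$-regular representation on $\ell^2(G)$. On $\Gamma$ let $\sigma_\theta\big((\tfrac{q_1}{p^{k_1}},\tfrac{q_2}{p^{k_2}}),(\tfrac{q_3}{p^{k_3}},\tfrac{q_4}{p^{k_4}})\big)=e^{2\pi i\theta_{k_1+k_4}q_1q_4}$,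 with restriction $(\sigma_\theta)_j$ to $\Gamma_j$; on $\mathbb Z^2$, for $\alpha\in\mathbb R$, let $\sigma_\alpha(z,y)=e^{\pi i\alpha(z_1y_2-z_2y_1)}$. The noncommutative solenoid is $\mathcal A_\theta^{\mathcal S}=C^*(\Gamma,\sigma_\theta)$. Let $\upsilon_j:C^*(\mathbb Z^2,\sigma_{\theta_{2j}})\to C^*(\Gamma_j,(\sigma_\theta)_j)$ be the $*$-isomorphism with $\delta_{(1,0)}\mapsto\delta_{(p^{-j},0)}$, $\delta_{(0,1)}\mapsto\delta_{(0,p^{-j})}$; let $\beta_{j,k}:C^*(\Gamma_j,(\sigma_\theta)_j)\to C^*(\Gamma_k,(\sigma_\theta)_k)$ ($j\le k$) and $\beta_j:C^*(\Gamma_j,(\sigma_\theta)_j)\to\mathcal A_\theta^{\mathcal S}$ be induced by the inclusions of groups, and put $\phi_{j,k}=\upsilon_k^{-1}\beta_{j,k}\upsilon_j$, $\phi_j=\beta_j\upsilon_j$. Let $I_{j,k}:\ell^2(\Gamma_j)\to\ell^2(\Gamma_k)$ and $I_j:\ell^2(\Gamma_j)\to\ell^2(\Gamma)$ be the inclusions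 (extension by zero). *Operators.* Let $\mathbb L_p^\Sigma(r,s)=|r|+\|r\|_p+|s|+\|s\|_p$ on $\Gamma$, where $\|\cdot\|_p$ is the $p$-adic norm. Let $\mathcal D_p$ be multiplication by $\mathbb L_p^\Sigma$ on $\ell^2(\Gamma)$ and $D_{p,j}$ multiplication by $\mathbb L_p^\Sigma|_{\Gamma_j}$ on $\ell^2(\Gamma_j)$, both on their maximal domains. *Spectral triples.* A spectral triple $(A,H,D)$ with smooth subalgebra $\mathcal A$ consists of a unital $C^*$-algebra $A$ with a faithful unital representation $\pi$ on a Hilbert space $H$, a self-adjoint operator $D$ on $H$ with compact resolvent, and a dense $*$-subalgebra $\mathcal A\subset A$ such that for each $a\in\mathcal A$ the commutator $[D,\pi(a)]$ is densely defined and extends to a bounded operator. An isometric morphism $(A_1,H_1,D_1)\to(A_2,H_2,D_2)$ is a pair $(\phi,I)$ of an injective unital $*$-homomorphism $\phi:A_1\to A_2$ and a linear isometry $I:H_1\to H_2$ with $\phi(\mathcal A_1)\subset\mathcal A_2$, $I\pi_1(a)=\pi_2(\phi(a))I$ for all $a\in A_1$, $I(\operatorname{dom}D_1)\subset\operatorname{dom}D_2$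 and $ID_1=D_2I$ on $\operatorname{dom}D_1$. An inductive system of spectral triples is a family of spectral triples indexed by a directed set with isometric morphisms $(\phi_{j,k},I_{j,k})$, $j\le k$, such that $\phi_{k,l}\phi_{j,k}=\phi_{j,l}$ and $I_{k,l}I_{j,k}=I_{j,l}$. Its inductive realization (Floricel–Ghorbanpour) is $(A,H,D)$ with subalgebra $\mathcal A$, where $A=\varinjlim A_j$ (as $C^*$-algebras), $H=\varinjlim H_j$, $\pi=\varinjlim\pi_j$, $\mathcal A=\bigcup_j\phi_j(\mathcal A_j)$ is the algebraic direct limit, and $D$ is the closure of the operator $I_j\xi\mapsto I_jD_j\xi$ ($\xi\in\operatorname{dom}D_j$) on $\bigcup_jI_j(\operatorname{dom}D_j)$. **Theorem.** 1. The triples $(C^*(\mathbb Z^2,\sigma_{\theta_{2j}}),\ell^2(\Gamma_j),D_{p,j})$, with representations $\lambda_{(\sigma_\theta)_j}\circ\upsilon_j$ and smooth subalgebras $C_C(\mathbb Z^2,\sigma_{\theta_{2j}})$, together with the maps $(\phi_{j,k},I_{j,k})$, form an inductive system of spectral triples over $\mathbb N$. 2. The triple $(\mathcal A_\theta^{\mathcal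 S},\ell^2(\Gamma),\mathcal D_p)$, with representation $\lambda_{\sigma_\theta}$ and subalgebra $C_C(\Gamma,\sigma_\theta)$, is the inductive realization of this system, with canonical maps $\phi_j$ and $I_j$. 3. The system satisfies the Floricel–Ghorbanpour criteria: for every $z\in\mathbb C\setminus\mathbb R$ the operators $I_j(D_{p,j}-z)^{-1}I_j^*$ converge in norm to $(\mathcal D_p-z)^{-1}$ as $j\to\infty$; and for every $j$ and every $a\in C_C(\mathbb Z^2,\sigma_{\theta_{2j}})$ the commutators $[D_{p,k},\lambda_{(\sigma_\theta)_k}(\upsilon_k(\phi_{j,k}(a)))]$, $k\ge j$, are uniformly bounded. 4. The inductive realization $(\mathcal A_\theta^{\mathcal S},\ell^2(\Gamma),\mathcal D_p)$ is a spectral triple, with smooth subalgebra $C_C(\Gamma,\sigma_\theta)$. -/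

import Mathlib

open scoped ENNReal

universe u v

namespace NCSolenoid

/-! ## Spectral triples and inductive systems of spectral triples -/

section SpectralTriples

variable {A : Type*} [CStarAlgebra A]
variable {H : Type*} [NormedAddCommGroup H] [InnerProductSpace ℂ H] [CompleteSpace H]

/-- The commutator `[D, T] = D T - T D` of an unbounded operator `D` and a bounded operator `T`,
on its natural domain `{ξ ∈ dom D | T ξ ∈ dom D}`. -/
def commutator (D : H →ₗ.[ℂ] H) (T : H →L[ℂ] H) : H →ₗ.[ℂ] H where
  domain := D.domain ⊓ D.domain.comap T.toLinearMap
  toFun :=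
    { toFun := fun ξ => D ⟨T ξ, ξ.2.2⟩ - T (D ⟨ξ, ξ.2.1⟩)
      map_add' := by
        intro ξ η
        have h1 : (⟨T ((ξ + η : _) : H), (ξ + η).2.2⟩ : D.domain)
            = ⟨T ξ, ξ.2.2⟩ + ⟨T η, η.2.2⟩ := Subtype.ext (by simp)
        have h2 : (⟨((ξ + η : _) : H), (ξ + η).2.1⟩ : D.domain)
            = ⟨ξ, ξ.2.1⟩ + ⟨η, η.2.1⟩ := Subtype.ext (by simp)
        rw [h1, h2, D.map_add, D.map_add, map_add]
        abel
      map_smul' := by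
        intro c ξ
        have h1 : (⟨T ((c • ξ : _) : H), (c • ξ).2.2⟩ : D.domain)
            = c • ⟨T ξ, ξ.2.2⟩ := Subtype.ext (by simp)
        have h2 : (⟨((c • ξ : _) : H), (c • ξ).2.1⟩ : D.domain)
            = c • ⟨ξ, ξ.2.1⟩ := Subtype.ext (by simp)
        rw [h1, h2, D.map_smul, D.map_smul, map_smul, RingHom.id_apply, smul_sub] }

/-- `R` is the resolvent `(D - z)⁻¹` of the unbounded operator `D` at `z`: a bounded everywhere
defined operator which is a two-sided inverse of `D - z : dom D → H`. -/
structure IsResolventAt (D : H →ₗ.[ℂ] H) (z : ℂ) (R : H →L[ℂ] H) : Prop where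
  mem_domain : ∀ x : H, R x ∈ D.domain
  right_inv : ∀ x : H, D ⟨R x, mem_domain x⟩ - z • R x = x
  left_inv : ∀ ξ : D.domain, R (D ξ - z • (ξ : H)) = ξ

/-- `D` has compact resolvent: the resolvent set is nonempty and `(D - z)⁻¹` is compact for every
`z` in the resolvent set. -/
def HasCompactResolvent (D : H →ₗ.[ℂ] H) : Prop :=
  (∃ z R, IsResolventAt D z R) ∧
    ∀ (z : ℂ) (R : H →L[ℂ] H), IsResolventAt D z R → IsCompactOperator R

variable (A H) in
/-- The data of a candidate spectral triple `(A, H, D)`: a unital `*`-representation of `A` on `H`,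
an unbounded operator `D` on `H`, and a (candidate smooth) `*`-subalgebra of `A`. -/
structure TripleData where
  /-- the representation `π` of `A` on `H` -/
  rep : A →⋆ₐ[ℂ] (H →L[ℂ] H)
  /-- the operator `D` -/
  dirac : H →ₗ.[ℂ] H
  /-- the `*`-subalgebra of smooth elements -/
  smooth : StarSubalgebra ℂ A

/-- `(A, H, D)` is a spectral triple with the given smooth subalgebra: the representation is
faithful, `D` is self-adjoint with compact resolvent, the smooth subalgebra is dense, and for each
`a` in it the commutator `[D, π(a)]` is densely defined and extends to a bounded operator. -/
structure TripleData.IsSpectralTriple (T : TripleData A H) : Prop where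
  faithful : Function.Injective T.rep
  selfAdjoint : IsSelfAdjoint T.dirac
  compactResolvent : HasCompactResolvent T.dirac
  dense_smooth : Dense (T.smooth : Set A)
  dense_commutator : ∀ a ∈ T.smooth, Dense ((commutator T.dirac (T.rep a)).domain : Set H)
  bounded_commutator : ∀ a ∈ T.smooth, ∃ B : H →L[ℂ] H,
    ∀ ξ : (commutator T.dirac (T.rep a)).domain, commutator T.dirac (T.rep a) ξ = B ξ

variable {A₁ A₂ H₁ H₂ : Type*} [CStarAlgebra A₁] [CStarAlgebra A₂]
variable [NormedAddCommGroup H₁] [InnerProductSpace ℂ H₁] [CompleteSpace H₁]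
variable [NormedAddCommGroup H₂] [InnerProductSpace ℂ H₂] [CompleteSpace H₂]

/-- `(φ, I)` is a morphism of spectral triples from `T₁` to `T₂`. -/
structure IsMorphism (T₁ : TripleData A₁ H₁) (T₂ : TripleData A₂ H₂)
    (φ : A₁ →⋆ₐ[ℂ] A₂) (I : H₁ →L[ℂ] H₂) : Prop where
  map_smooth : ∀ a ∈ T₁.smooth, φ a ∈ T₂.smooth
  intertwine : ∀ a : A₁, I ∘L T₁.rep a = T₂.rep (φ a) ∘L I
  map_domain : ∀ ξ ∈ T₁.dirac.domain, I ξ ∈ T₂.dirac.domain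
  map_dirac : ∀ ξ : T₁.dirac.domain, I (T₁.dirac ξ) = T₂.dirac ⟨I ξ, map_domain ξ ξ.2⟩

/-- An isometric morphism: `φ` is injective and `I` is an isometry. -/
structure IsIsometricMorphism (T₁ : TripleData A₁ H₁) (T₂ : TripleData A₂ H₂)
    (φ : A₁ →⋆ₐ[ℂ] A₂) (I : H₁ →L[ℂ] H₂) : Prop extends IsMorphism T₁ T₂ φ I where
  injective : Function.Injective φ
  isometry : Isometry I

variable {J : Type*} [Preorder J] [IsDirectedOrder J] [Nonempty J]
variable {AJ : J → Type*} [∀ j, CStarAlgebra (AJ j)]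
variable {HJ : J → Type*} [∀ j, NormedAddCommGroup (HJ j)] [∀ j, InnerProductSpace ℂ (HJ j)]
  [∀ j, CompleteSpace (HJ j)]

/-- An inductive system of spectral triples over the directed set `J`. -/
structure IsInductiveSystem (T : ∀ j, TripleData (AJ j) (HJ j))
    (φ : ∀ j k, j ≤ k → (AJ j →⋆ₐ[ℂ] AJ k)) (I : ∀ j k, j ≤ k → (HJ j →L[ℂ] HJ k)) : Prop where
  isSpectralTriple : ∀ j, (T j).IsSpectralTriple
  isIsometricMorphism : ∀ j k (h : j ≤ k), IsIsometricMorphism (T j) (T k) (φ j k h) (I j k h)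
  comp_alg : ∀ j k l (hjk : j ≤ k) (hkl : k ≤ l),
    (φ k l hkl).comp (φ j k hjk) = φ j l (hjk.trans hkl)
  comp_hilbert : ∀ j k l (hjk : j ≤ k) (hkl : k ≤ l),
    I k l hkl ∘L I j k hjk = I j l (hjk.trans hkl)

/-- `(A, φ_j)` is the inductive limit C*-algebra of the system `(A_j, φ_{jk})` of C*-algebras with
injective connecting maps, that is, the completion of the algebraic direct limit: the `φ_j` are
compatible injective (hence isometric) `*`-homomorphisms and the union of their ranges is dense. -/
structure IsCStarLimit (φ : ∀ j k, j ≤ k → (AJ j →⋆ₐ[ℂ] AJ k)) (φlim : ∀ j, AJ j →⋆ₐ[ℂ] A) :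
    Prop where
  compat : ∀ j k (h : j ≤ k), (φlim k).comp (φ j k h) = φlim j
  injective : ∀ j, Function.Injective (φlim j)
  dense : Dense (⋃ j, Set.range (φlim j))

/-- `(H, I_j)` is the inductive limit Hilbert space of the system `(H_j, I_{jk})` of Hilbert spaces
with isometric connecting maps: the `I_j` are compatible isometries and the union of their ranges is
dense. -/
structure IsHilbertLimit (I : ∀ j k, j ≤ k → (HJ j →L[ℂ] HJ k)) (Ilim : ∀ j, HJ j →L[ℂ] H) :
    Prop where
  compat : ∀ j k (h : j ≤ k), Ilim k ∘L I j k h = Ilim j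
  isometry : ∀ j, Isometry (Ilim j)
  dense : Dense (⋃ j, Set.range (Ilim j))

/-- `D₀` is the operator with domain `⋃ j, I_j (dom D_j)` given by `D₀ (I_j ξ) = I_j (D_j ξ)`. -/
structure IsAlgebraicLimitOperator (D : ∀ j, HJ j →ₗ.[ℂ] HJ j) (Ilim : ∀ j, HJ j →L[ℂ] H)
    (D₀ : H →ₗ.[ℂ] H) : Prop where
  domain_eq : (D₀.domain : Set H) = ⋃ j, Ilim j '' ((D j).domain : Set (HJ j))
  apply_eq : ∀ (j : J) (ξ : (D j).domain) (η : D₀.domain), (η : H) = Ilim j ξ →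
    D₀ η = Ilim j (D j ξ)

/-- `T` is the inductive realization of the inductive system `(T_j, (φ_{jk}, I_{jk}))`, with
canonical maps `φ_j : A_j → A` and `I_j : H_j → H`: the algebra, the Hilbert space, the
representation and the smooth subalgebra are the respective inductive limits (the last one in the
algebraic sense), and the operator is the closure of the operator `D₀ (I_j ξ) = I_j (D_j ξ)` on
`⋃ j, I_j (dom D_j)`. -/
structure IsInductiveRealization (T : ∀ j, TripleData (AJ j) (HJ j))
    (φ : ∀ j k, j ≤ k → (AJ j →⋆ₐ[ℂ] AJ k)) (I : ∀ j k, j ≤ k → (HJ j →L[ℂ] HJ k))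
    (Tlim : TripleData A H) (φlim : ∀ j, AJ j →⋆ₐ[ℂ] A) (Ilim : ∀ j, HJ j →L[ℂ] H) : Prop where
  algebra : IsCStarLimit φ φlim
  hilbert : IsHilbertLimit I Ilim
  rep : ∀ j (a : AJ j), Tlim.rep (φlim j a) ∘L Ilim j = Ilim j ∘L (T j).rep a
  smooth : (Tlim.smooth : Set A) = ⋃ j, φlim j '' ((T j).smooth : Set (AJ j))
  dirac : ∃ D₀ : H →ₗ.[ℂ] H, IsAlgebraicLimitOperator (fun j => (T j).dirac) Ilim D₀ ∧
    D₀.IsClosable ∧ Tlim.dirac = D₀.closure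

/-- The resolvent criterion: for every non-real `z` the operators `I_j (D_j - z)⁻¹ I_j^*` converge
to `(D - z)⁻¹` in operator norm (and all these resolvents exist). -/
def ResolventsConverge (D : ∀ j, HJ j →ₗ.[ℂ] HJ j) (Ilim : ∀ j, HJ j →L[ℂ] H)
    (Dlim : H →ₗ.[ℂ] H) : Prop :=
  ∀ z : ℂ, z.im ≠ 0 → ∃ (R : ∀ j, HJ j →L[ℂ] HJ j) (Rlim : H →L[ℂ] H),
    (∀ j, IsResolventAt (D j) z (R j)) ∧ IsResolventAt Dlim z Rlim ∧
    Filter.Tendsto (fun j => Ilim j ∘L R j ∘L (Ilim j).adjoint) Filter.atTop (nhds Rlim)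

/-- The commutator criterion: for every `j` and every smooth `a ∈ A_j`, the family of operators
`[D_k, π_k (φ_{jk} a)]`, `k ≥ j`, is uniformly bounded. -/
def CommutatorsUniformlyBounded (T : ∀ j, TripleData (AJ j) (HJ j))
    (φ : ∀ j k, j ≤ k → (AJ j →⋆ₐ[ℂ] AJ k)) : Prop :=
  ∀ j, ∀ a ∈ (T j).smooth, ∃ C : ℝ, ∀ k (h : j ≤ k),
    ∀ ξ : (commutator (T k).dirac ((T k).rep (φ j k h a))).domain,
      ‖commutator (T k).dirac ((T k).rep (φ j k h a)) ξ‖ ≤ C * ‖(ξ : HJ k)‖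

end SpectralTriples

/-! ## Twisted group C*-algebras -/

/-- A multiplier on a discrete group (written additively): a normalized 2-cocycle with values in the
unit circle. -/
structure Multiplier (G : Type u) [AddGroup G] where
  toFun : G → G → Circle
  cocycle : ∀ a b c, toFun a b * toFun (a + b) c = toFun a (b + c) * toFun b c
  zero_left : ∀ a, toFun 0 a = 1
  zero_right : ∀ a, toFun a 0 = 1

namespace Multiplier

variable {G : Type u} [AddGroup G] {K : Type u} [AddGroup K]

instance : CoeFun (Multiplier G) (fun _ => G → G → Circle) := ⟨Multiplier.toFun⟩

/-- The pull-back of a multiplier along a group homomorphism; in particular the restriction of a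
multiplier to a subgroup. -/
def comap (τ : Multiplier K) (h : G →+ K) : Multiplier G where
  toFun a b := τ (h a) (h b)
  cocycle a b c := by simpa using τ.cocycle (h a) (h b) (h c)
  zero_left a := by simpa using τ.zero_left (h a)
  zero_right a := by simpa using τ.zero_right (h a)

end Multiplier

/-- A projective unitary representation of `G` with multiplier `σ`: a family of unitaries `W_g` on
a (nonzero) Hilbert space with `W_a W_b = σ(a,b) W_{a+b}`. -/
structure ProjRep {G : Type u} [AddGroup G] (σ : Multiplier G) where
  space : Type u
  [normedAddCommGroup : NormedAddCommGroup space]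
  [innerProductSpace : InnerProductSpace ℂ space]
  [completeSpace : CompleteSpace space]
  [nontrivial : Nontrivial space]
  W : G → (space →L[ℂ] space)
  unitary : ∀ g, W g ∈ unitary (space →L[ℂ] space)
  mul : ∀ a b, W a * W b = (σ a b : ℂ) • W (a + b)

attribute [instance] ProjRep.normedAddCommGroup ProjRep.innerProductSpace ProjRep.completeSpace
  ProjRep.nontrivial

section TwistedGroupAlgebra

variable {G : Type u} [AddGroup G] {K : Type u} [AddGroup K]

/-- Bounded families `(x_W)` with `x_W` a bounded operator on the space of `W`, where `W` runs over
all projective representations with multiplier `σ` (the block-diagonal operators on the direct sum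
of all these representations), with the supremum norm. -/
def UniversalOperators (σ : Multiplier G) : Type (u + 1) :=
  lp (fun W : ProjRep σ => W.space →L[ℂ] W.space) ∞

/-- The C*-algebra structure, with componentwise operations. -/
noncomputable def universalOperatorsCStarAlgebra (σ : Multiplier G) :
    CStarAlgebra (lp (fun W : ProjRep σ => W.space →L[ℂ] W.space) ∞) where

noncomputable instance (σ : Multiplier G) : CStarAlgebra (UniversalOperators σ) :=
  universalOperatorsCStarAlgebra σ

namespace UniversalOperators

/-- The bounded family with components `x W`. -/
def ofBounded (σ : Multiplier G) (x : ∀ W : ProjRep σ, W.space →L[ℂ] W.space)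
    (hx : BddAbove (Set.range fun W => ‖x W‖)) : UniversalOperators σ :=
  ⟨x, memℓp_infty hx⟩

/-- The component at the representation `W`. -/
noncomputable def proj {σ : Multiplier G} (W : ProjRep σ) :
    UniversalOperators σ →⋆ₐ[ℂ] (W.space →L[ℂ] W.space) where
  toFun x := x.1 W
  map_one' := rfl
  map_mul' _ _ := rfl
  map_zero' := rfl
  map_add' _ _ := rfl
  commutes' _ := rfl
  map_star' _ := rfl

theorem ext {σ : Multiplier G} {x y : UniversalOperators σ} (h : ∀ W, proj W x = proj W y) :
    x = y :=
  lp.ext (funext h)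

theorem norm_proj_le {σ : Multiplier G} (W : ProjRep σ) (x : UniversalOperators σ) :
    ‖proj W x‖ ≤ ‖x‖ :=
  lp.norm_apply_le_norm ENNReal.top_ne_zero x W

/-- The norm is the supremum of the norms of the components. -/
theorem norm_eq_iSup {σ : Multiplier G} (x : UniversalOperators σ) : ‖x‖ = ⨆ W, ‖proj W x‖ :=
  lp.norm_eq_ciSup x

end UniversalOperators

open UniversalOperators

theorem ProjRep.norm_W_le {σ : Multiplier G} (W : ProjRep σ) (g : G) : ‖W.W g‖ ≤ 1 :=
  CStarRing.norm_of_mem_unitary (W.unitary g) |>.le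

/-- The direct sum `⊕_W W_g` of the unitaries `W_g` over all projective representations `W`. -/
noncomputable def universalUnitary (σ : Multiplier G) (g : G) : UniversalOperators σ :=
  ofBounded σ (fun W => W.W g) ⟨1, by rintro _ ⟨W, rfl⟩; exact W.norm_W_le g⟩

@[simp] theorem proj_universalUnitary {σ : Multiplier G} (W : ProjRep σ) (g : G) :
    proj W (universalUnitary σ g) = W.W g := rfl

/-- The norm-closed `*`-algebra generated by the unitaries `⊕_W W_g`. -/
noncomputable def universalSubalgebra (σ : Multiplier G) :
    StarSubalgebra ℂ (UniversalOperators σ) :=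
  (StarAlgebra.adjoin ℂ (Set.range (universalUnitary σ))).topologicalClosure

theorem isClosed_universalSubalgebra (σ : Multiplier G) :
    IsClosed (universalSubalgebra σ : Set (UniversalOperators σ)) :=
  StarSubalgebra.isClosed_topologicalClosure _

theorem universalUnitary_mem (σ : Multiplier G) (g : G) :
    universalUnitary σ g ∈ universalSubalgebra σ :=
  StarSubalgebra.le_topologicalClosure _ (StarAlgebra.subset_adjoin ℂ _ ⟨g, rfl⟩)

/-- The full twisted group C*-algebra `C*(G, σ)`, the universal C*-algebra generated by projective
representations of `G` with multiplier `σ`: the C*-algebra generated by the direct sum of all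
projective unitary representations with multiplier `σ`. The norm of `∑ f(g) δ_g` is the supremum of
`‖∑ f(g) W_g‖` over all such representations `W`. -/
def TwistedGroupCStar (σ : Multiplier G) : Type (u + 1) := universalSubalgebra σ

/-- The C*-algebra structure inherited from the algebra of universal operators. -/
noncomputable def universalSubalgebraCStarAlgebra (σ : Multiplier G) :
    CStarAlgebra (universalSubalgebra σ) :=
  haveI := isClosed_universalSubalgebra σ
  StarSubalgebra.cstarAlgebra (universalSubalgebra σ)

noncomputable instance (σ : Multiplier G) : CStarAlgebra (TwistedGroupCStar σ) :=
  universalSubalgebraCStarAlgebra σ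

namespace TwistedGroupCStar

/-- The inclusion of `C*(G, σ)` into the operators on the direct sum of all representations. -/
noncomputable def incl (σ : Multiplier G) : TwistedGroupCStar σ →⋆ₐ[ℂ] UniversalOperators σ :=
  (universalSubalgebra σ).subtype

/-- The canonical unitary generator `δ_g` of `C*(G, σ)`. -/
noncomputable def delta (σ : Multiplier G) (g : G) : TwistedGroupCStar σ :=
  ⟨universalUnitary σ g, universalUnitary_mem σ g⟩

theorem incl_injective (σ : Multiplier G) : Function.Injective (incl σ) :=
  Subtype.val_injective

@[simp] theorem incl_delta (σ : Multiplier G) (g : G) : incl σ (delta σ g) = universalUnitary σ g :=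
  rfl

theorem delta_mul (σ : Multiplier G) (a b : G) :
    delta σ a * delta σ b = (σ a b : ℂ) • delta σ (a + b) := by
  apply incl_injective
  refine UniversalOperators.ext fun W => ?_
  simp only [map_mul, map_smul, incl_delta, proj_universalUnitary, W.mul]

theorem delta_zero (σ : Multiplier G) : delta σ 0 = 1 := by
  apply incl_injective
  refine UniversalOperators.ext fun W => ?_
  rw [map_one, map_one, incl_delta, proj_universalUnitary]
  have h := W.mul 0 0
  rw [σ.zero_left, add_zero, Circle.coe_one, one_smul] at h
  have hu := (Unitary.mem_iff.1 (W.unitary 0)).1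
  calc W.W 0 = (star (W.W 0) * W.W 0) * W.W 0 := by rw [hu, one_mul]
    _ = 1 := by rw [mul_assoc, h, hu]

theorem star_delta (σ : Multiplier G) (g : G) :
    star (delta σ g) = (star (σ g (-g) : ℂ)) • delta σ (-g) := by
  have hu : star (delta σ g) * delta σ g = 1 := by
    apply incl_injective
    refine UniversalOperators.ext fun W => ?_
    simp only [map_mul, map_star, map_one, incl_delta, proj_universalUnitary]
    exact (Unitary.mem_iff.1 (W.unitary g)).1
  have h := delta_mul σ g (-g)
  rw [add_neg_cancel, delta_zero] at h
  have hc : (star (σ g (-g) : ℂ)) * (σ g (-g) : ℂ) = 1 := by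
    rw [Complex.star_def, ← Circle.coe_inv_eq_conj, Circle.coe_inv]
    exact inv_mul_cancel₀ (Circle.coe_ne_zero _)
  calc star (delta σ g)
      = star (delta σ g) * ((star (σ g (-g) : ℂ)) • ((σ g (-g) : ℂ) • 1)) := by
        rw [smul_smul, hc, one_smul, mul_one]
    _ = (star (σ g (-g) : ℂ)) • ((star (delta σ g) * delta σ g) * delta σ (-g)) := by
        rw [← h, mul_smul_comm, mul_assoc]
    _ = _ := by rw [hu, one_mul]

/-- The element `∑ f(g) δ_g` of `C*(G, σ)` given by a finitely supported function `f`. -/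
noncomputable def ofFinsupp (σ : Multiplier G) : (G →₀ ℂ) →ₗ[ℂ] TwistedGroupCStar σ :=
  Finsupp.linearCombination ℂ (delta σ)

theorem range_ofFinsupp (σ : Multiplier G) :
    LinearMap.range (ofFinsupp σ) = Submodule.span ℂ (Set.range (delta σ)) :=
  Finsupp.range_linearCombination ℂ

/-- The dense `*`-subalgebra `C_C(G, σ)` of `C*(G, σ)` of finitely supported functions. -/
noncomputable def finitelySupported (σ : Multiplier G) : StarSubalgebra ℂ (TwistedGroupCStar σ) where
  carrier := Set.range (ofFinsupp σ)
  add_mem' := by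
    rintro _ _ ⟨f, rfl⟩ ⟨g, rfl⟩
    exact ⟨f + g, map_add _ _ _⟩
  zero_mem' := ⟨0, map_zero _⟩
  one_mem' := ⟨Finsupp.single 0 1, by simp [ofFinsupp, delta_zero]⟩
  algebraMap_mem' c := ⟨Finsupp.single 0 c, by
    simp [ofFinsupp, delta_zero, Algebra.algebraMap_eq_smul_one]⟩
  mul_mem' := by
    intro x y hx hy
    have key : ∀ z, z ∈ Set.range (ofFinsupp σ) ↔ z ∈ Submodule.span ℂ (Set.range (delta σ)) := by
      intro z; rw [← range_ofFinsupp]; rfl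
    rw [key] at hx hy ⊢
    induction hx using Submodule.span_induction with
    | mem x hx =>
      obtain ⟨a, rfl⟩ := hx
      induction hy using Submodule.span_induction with
      | mem y hy =>
        obtain ⟨b, rfl⟩ := hy
        rw [delta_mul]
        exact Submodule.smul_mem _ _ (Submodule.subset_span ⟨_, rfl⟩)
      | zero => rw [mul_zero]; exact Submodule.zero_mem _
      | add y z _ _ hy hz => rw [mul_add]; exact Submodule.add_mem _ hy hz
      | smul c y _ hy => rw [mul_smul_comm]; exact Submodule.smul_mem _ _ hy
    | zero => rw [zero_mul]; exact Submodule.zero_mem _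
    | add y z _ _ hy hz => rw [add_mul]; exact Submodule.add_mem _ hy hz
    | smul c y _ hy => rw [smul_mul_assoc]; exact Submodule.smul_mem _ _ hy
  star_mem' := by
    intro x hx
    have key : ∀ z, z ∈ Set.range (ofFinsupp σ) ↔ z ∈ Submodule.span ℂ (Set.range (delta σ)) := by
      intro z; rw [← range_ofFinsupp]; rfl
    rw [key] at hx ⊢
    induction hx using Submodule.span_induction with
    | mem x hx =>
      obtain ⟨a, rfl⟩ := hx
      rw [star_delta]
      exact Submodule.smul_mem _ _ (Submodule.subset_span ⟨_, rfl⟩)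
    | zero => rw [star_zero]; exact Submodule.zero_mem _
    | add y z _ _ hy hz => rw [star_add]; exact Submodule.add_mem _ hy hz
    | smul c y _ hy => rw [star_smul]; exact Submodule.smul_mem _ _ hy

/-- `*`-homomorphisms out of `C*(G, σ)` are determined by their values on the generators. -/
theorem hom_ext {σ : Multiplier G} {B : Type v} [CStarAlgebra B]
    {f g : TwistedGroupCStar σ →⋆ₐ[ℂ] B} (h : ∀ a, f (delta σ a) = g (delta σ a)) : f = g := by
  have hf : Continuous f :=
    AddMonoidHomClass.continuous_of_bound f 1 fun x => by
      simpa using NonUnitalStarAlgHom.norm_apply_le f x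
  have hg : Continuous g :=
    AddMonoidHomClass.continuous_of_bound g 1 fun x => by
      simpa using NonUnitalStarAlgHom.norm_apply_le g x
  refine StarAlgHom.ext_topologicalClosure (R := ℂ) (A := UniversalOperators σ) (B := B)
    (S := StarAlgebra.adjoin ℂ (Set.range (universalUnitary σ))) hf hg ?_
  refine StarAlgHom.ext_adjoin ?_
  rintro ⟨x, hx⟩ ⟨a, ha⟩
  simp only at ha
  subst ha
  exact h a

/-- The `*`-representation of `C*(G, σ)` given by a projective representation `W` with multiplier
`σ`; it maps `δ_g` to `W_g`. -/
noncomputable def repOf {σ : Multiplier G} (W : ProjRep σ) :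
    TwistedGroupCStar σ →⋆ₐ[ℂ] (W.space →L[ℂ] W.space) :=
  (proj W).comp (incl σ)

@[simp] theorem repOf_delta {σ : Multiplier G} (W : ProjRep σ) (g : G) :
    repOf W (delta σ g) = W.W g := rfl

end TwistedGroupCStar

/-- The norm of `C*(G, σ)` on finitely supported functions is the enveloping C*-norm. -/
theorem TwistedGroupCStar.norm_ofFinsupp (σ : Multiplier G) (f : G →₀ ℂ) :
    ‖TwistedGroupCStar.ofFinsupp σ f‖
      = ⨆ W : ProjRep σ, ‖f.sum fun g c => c • W.W g‖ := by
  have h (x : TwistedGroupCStar σ) : ‖x‖ = ‖TwistedGroupCStar.incl σ x‖ := rfl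
  rw [h, UniversalOperators.norm_eq_iSup]
  congr 1
  funext W
  simp [TwistedGroupCStar.ofFinsupp, Finsupp.linearCombination_apply, Finsupp.sum, map_sum]

/-- For a homomorphism `h : G → K` and `b : G → 𝕋` with
`σ(x,y) b(x+y) = b(x) b(y) τ(h x, h y)`, the projective representation `x ↦ b(x) W_{h x}` of `G`
obtained from a projective representation `W` of `K`. -/
noncomputable def ProjRep.pullback {σ : Multiplier G} {τ : Multiplier K} (h : G →+ K)
    (b : G → Circle) (hb : ∀ x y, σ x y * b (x + y) = b x * b y * τ (h x) (h y))
    (W : ProjRep τ) : ProjRep σ where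
  space := W.space
  W x := (b x : ℂ) • W.W (h x)
  unitary x := by
    have hu := Unitary.mem_iff.1 (W.unitary (h x))
    have hc : (star (b x : ℂ)) * (b x : ℂ) = 1 := by
      rw [Complex.star_def, ← Circle.coe_inv_eq_conj, Circle.coe_inv]
      exact inv_mul_cancel₀ (Circle.coe_ne_zero _)
    refine Unitary.mem_iff.2 ⟨?_, ?_⟩
    · rw [star_smul, smul_mul_smul_comm, hc, hu.1, one_smul]
    · rw [star_smul, smul_mul_smul_comm, mul_comm, hc, hu.2, one_smul]
  mul x y := by
    rw [smul_mul_smul_comm, W.mul, smul_smul, smul_smul, map_add]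
    congr 1
    exact_mod_cast (congrArg (Circle.coeHom) (hb x y)).symm

namespace TwistedGroupCStar

/-- The `*`-homomorphism `(x_W)_W ↦ (x_{pullback W})_W` of universal operators. -/
noncomputable def mapUniversal {σ : Multiplier G} {τ : Multiplier K} (h : G →+ K)
    (b : G → Circle) (hb : ∀ x y, σ x y * b (x + y) = b x * b y * τ (h x) (h y)) :
    UniversalOperators σ →⋆ₐ[ℂ] UniversalOperators τ where
  toFun x := ofBounded τ (fun W => proj (W.pullback h b hb) x) ⟨‖x‖, by
    rintro _ ⟨W, rfl⟩
    exact norm_proj_le (W.pullback h b hb) x⟩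
  map_one' := rfl
  map_mul' _ _ := rfl
  map_zero' := rfl
  map_add' _ _ := rfl
  commutes' _ := rfl
  map_star' _ := rfl

theorem mapUniversal_mem {σ : Multiplier G} {τ : Multiplier K} (h : G →+ K)
    (b : G → Circle) (hb : ∀ x y, σ x y * b (x + y) = b x * b y * τ (h x) (h y))
    (x : TwistedGroupCStar σ) : mapUniversal h b hb (incl σ x) ∈ universalSubalgebra τ := by
  have hF : Continuous (mapUniversal h b hb) :=
    AddMonoidHomClass.continuous_of_bound (mapUniversal h b hb) 1 fun x => by
      simpa using NonUnitalStarAlgHom.norm_apply_le (mapUniversal h b hb) x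
  have hle : universalSubalgebra σ ≤ (universalSubalgebra τ).comap (mapUniversal h b hb) := by
    refine StarSubalgebra.topologicalClosure_minimal (StarAlgebra.adjoin_le ?_)
      ((isClosed_universalSubalgebra τ).preimage hF)
    rintro _ ⟨x, rfl⟩
    have hx : mapUniversal h b hb (universalUnitary σ x) = (b x : ℂ) • universalUnitary τ (h x) :=
      rfl
    rw [SetLike.mem_coe, StarSubalgebra.mem_comap, hx]
    exact SMulMemClass.smul_mem _ (universalUnitary_mem τ (h x))
  exact hle x.2

/-- The `*`-homomorphism `C*(G, σ) → C*(K, τ)`, `δ_x ↦ b(x) δ_{h x}`, for a homomorphism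
`h : G → K` and `b : G → 𝕋` with `σ(x,y) b(x+y) = b(x) b(y) τ(h x, h y)`. -/
noncomputable def map {σ : Multiplier G} {τ : Multiplier K} (h : G →+ K)
    (b : G → Circle) (hb : ∀ x y, σ x y * b (x + y) = b x * b y * τ (h x) (h y)) :
    TwistedGroupCStar σ →⋆ₐ[ℂ] TwistedGroupCStar τ where
  toFun x := ⟨mapUniversal h b hb (incl σ x), mapUniversal_mem h b hb x⟩
  map_one' := rfl
  map_mul' _ _ := rfl
  map_zero' := rfl
  map_add' _ _ := rfl
  commutes' _ := rfl
  map_star' _ := rfl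

@[simp] theorem map_delta {σ : Multiplier G} {τ : Multiplier K} (h : G →+ K)
    (b : G → Circle) (hb : ∀ x y, σ x y * b (x + y) = b x * b y * τ (h x) (h y)) (x : G) :
    map h b hb (delta σ x) = (b x : ℂ) • delta τ (h x) := rfl

theorem map_symm_compat {σ : Multiplier G} {τ : Multiplier K} (e : G ≃+ K)
    (b : G → Circle) (hb : ∀ x y, σ x y * b (x + y) = b x * b y * τ (e x) (e y)) (x y : K) :
    τ x y * (b (e.symm (x + y)))⁻¹ =
      (b (e.symm x))⁻¹ * (b (e.symm y))⁻¹ * σ (e.symm x) (e.symm y) := by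
  have h := hb (e.symm x) (e.symm y)
  rw [e.apply_symm_apply, e.apply_symm_apply, ← map_add] at h
  rw [mul_inv_eq_iff_eq_mul, mul_assoc _ (σ _ _), h, ← mul_inv, ← mul_assoc, inv_mul_cancel,
    one_mul]

/-- The `*`-isomorphism `C*(G, σ) ≅ C*(K, τ)`, `δ_x ↦ b(x) δ_{e x}`, for an isomorphism
`e : G ≅ K` and `b : G → 𝕋` with `σ(x,y) b(x+y) = b(x) b(y) τ(e x, e y)`. -/
noncomputable def mapEquiv {σ : Multiplier G} {τ : Multiplier K} (e : G ≃+ K)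
    (b : G → Circle) (hb : ∀ x y, σ x y * b (x + y) = b x * b y * τ (e x) (e y)) :
    TwistedGroupCStar σ ≃⋆ₐ[ℂ] TwistedGroupCStar τ :=
  StarAlgEquiv.ofStarAlgHom (map e.toAddMonoidHom b (by simpa using hb))
    (map e.symm.toAddMonoidHom (fun y => (b (e.symm y))⁻¹)
      (by simpa using map_symm_compat e b hb))
    (hom_ext fun a => by
      rw [StarAlgHom.comp_apply, map_delta, map_smul, map_delta, smul_smul]
      simp)
    (hom_ext fun a => by
      rw [StarAlgHom.comp_apply, map_delta, map_smul, map_delta, smul_smul]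
      simp)

@[simp] theorem mapEquiv_delta {σ : Multiplier G} {τ : Multiplier K} (e : G ≃+ K)
    (b : G → Circle) (hb : ∀ x y, σ x y * b (x + y) = b x * b y * τ (e x) (e y)) (x : G) :
    mapEquiv e b hb (delta σ x) = (b x : ℂ) • delta τ (e x) := rfl

end TwistedGroupCStar

end TwistedGroupAlgebra

/-! ## Hilbert spaces `ℓ²` and operators on them -/

section LTwo

/-- The Hilbert space `ℓ²(X)`. -/
abbrev LTwo (X : Type u) : Type u := lp (fun _ : X => ℂ) 2

theorem memLTwo_iff {X : Type u} (f : X → ℂ) :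
    Memℓp f 2 ↔ Summable fun x => ‖f x‖ ^ (2 : ℝ) := by
  have := memℓp_gen_iff (p := 2) (E := fun _ : X => ℂ) (f := f) (by norm_num)
  simpa using this

theorem LTwo.norm_rpow {X : Type u} (f : LTwo X) : ‖f‖ ^ (2 : ℝ) = ∑' x, ‖f x‖ ^ (2 : ℝ) := by
  have := lp.norm_rpow_eq_tsum (p := 2) (E := fun _ : X => ℂ) (by norm_num) f
  simpa using this

theorem LTwo.norm_eq_of_tsum {X Y : Type u} (f : LTwo X) (g : LTwo Y)
    (h : ∑' x, ‖f x‖ ^ (2 : ℝ) = ∑' y, ‖g y‖ ^ (2 : ℝ)) : ‖f‖ = ‖g‖ := by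
  rw [← LTwo.norm_rpow, ← LTwo.norm_rpow] at h
  exact (Real.rpow_left_inj (norm_nonneg _) (norm_nonneg _) two_ne_zero).1 h

/-- The operator `M_L` of pointwise multiplication by a real-valued function `L` on `ℓ²(X)`, on its
maximal domain `{f ∈ ℓ²(X) | L f ∈ ℓ²(X)}`. -/
def mulOperator {X : Type u} (L : X → ℝ) : LTwo X →ₗ.[ℂ] LTwo X where
  domain :=
    { carrier := {f | Memℓp (fun x => (L x : ℂ) * f x) 2}
      add_mem' := fun {f g} hf hg => by
        have h : (fun x => (L x : ℂ) * (f + g : LTwo X) x)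
            = (fun x => (L x : ℂ) * f x) + fun x => (L x : ℂ) * g x := by
          funext x; simp [mul_add]
        rw [Set.mem_ofPred_eq, h]
        exact Memℓp.add hf hg
      zero_mem' := by
        have h : (fun x => (L x : ℂ) * (0 : LTwo X) x) = 0 := by funext x; simp
        rw [Set.mem_ofPred_eq, h]
        exact zero_memℓp
      smul_mem' := fun c f hf => by
        have h : (fun x => (L x : ℂ) * (c • f : LTwo X) x) = c • fun x => (L x : ℂ) * f x := by
          funext x; simp [mul_left_comm]
        rw [Set.mem_ofPred_eq, h]
        exact Memℓp.const_smul hf c }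
  toFun :=
    { toFun := fun f => ⟨fun x => (L x : ℂ) * f.1 x, f.2⟩
      map_add' := fun f g => by
        apply lp.ext; funext x
        exact mul_add _ _ _
      map_smul' := fun c f => by
        apply lp.ext; funext x; simp [mul_left_comm] }

/-- The isometry `ℓ²(X) → ℓ²(Y)` given by an injection `e : X → Y` and extension by zero. -/
noncomputable def extendIsometry {X Y : Type u} (e : X → Y) (he : Function.Injective e) :
    LTwo X →ₗᵢ[ℂ] LTwo Y where
  toFun f := ⟨Function.extend e f 0, by
    have hf := (memLTwo_iff _).1 (lp.memℓp f)
    refine (memLTwo_iff _).2 ?_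
    have h : (fun y => ‖Function.extend e (f : X → ℂ) 0 y‖ ^ (2 : ℝ))
        = Function.extend e (fun x => ‖f x‖ ^ (2 : ℝ)) 0 := by
      funext y
      by_cases hy : ∃ x, e x = y
      · obtain ⟨x, rfl⟩ := hy
        simp [he.extend_apply]
      · simp [Function.extend_apply' _ _ _ hy]
    rw [h]
    exact (summable_extend_zero he).2 hf⟩
  map_add' f g := by
    apply lp.ext; funext y
    change Function.extend e (f + g : LTwo X) 0 y
      = Function.extend e f 0 y + Function.extend e g 0 y
    by_cases hy : ∃ x, e x = y
    · obtain ⟨x, rfl⟩ := hy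
      rw [he.extend_apply, he.extend_apply, he.extend_apply]
      rfl
    · simp only [Function.extend_apply' _ _ _ hy, Pi.zero_apply, add_zero]
  map_smul' c f := by
    apply lp.ext; funext y
    by_cases hy : ∃ x, e x = y
    · obtain ⟨x, rfl⟩ := hy
      simp [he.extend_apply]
    · simp [Function.extend_apply' _ _ _ hy]
  norm_map' f := by
    apply LTwo.norm_eq_of_tsum
    have h : (fun y => ‖Function.extend e (f : X → ℂ) 0 y‖ ^ (2 : ℝ))
        = Function.extend e (fun x => ‖f x‖ ^ (2 : ℝ)) 0 := by
      funext y
      by_cases hy : ∃ x, e x = y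
      · obtain ⟨x, rfl⟩ := hy
        simp [he.extend_apply]
      · simp [Function.extend_apply' _ _ _ hy]
    exact (congrArg tsum h).trans (tsum_extend_zero he _)

/-- The twisted translation `f ↦ (γ ↦ σ(a, -a + γ) f(-a + γ))` on `ℓ²(G)`. -/
noncomputable def twistedTranslation {G : Type u} [AddGroup G] (σ : Multiplier G) (a : G) :
    LTwo G →ₗᵢ[ℂ] LTwo G where
  toFun f := ⟨fun γ => (σ a (-a + γ) : ℂ) * f (-a + γ), by
    have hf := (memLTwo_iff _).1 (lp.memℓp f)
    refine (memLTwo_iff _).2 ?_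
    simpa [Function.comp_def, Circle.norm_coe] using ((Equiv.addLeft (-a)).summable_iff.2 hf)⟩
  map_add' f g := by
    apply lp.ext; funext γ
    exact mul_add _ _ _
  map_smul' c f := by
    apply lp.ext; funext γ; simp [mul_left_comm]
  norm_map' f := by
    apply LTwo.norm_eq_of_tsum
    simpa [Circle.norm_coe] using ((Equiv.addLeft (-a)).tsum_eq fun x => ‖f x‖ ^ (2 : ℝ))

@[simp] theorem twistedTranslation_apply {G : Type u} [AddGroup G] (σ : Multiplier G) (a : G)
    (f : LTwo G) (γ : G) :
    (twistedTranslation σ a f) γ = (σ a (-a + γ) : ℂ) * f (-a + γ) := rfl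

theorem twistedTranslation_mul {G : Type u} [AddGroup G] (σ : Multiplier G) (a b : G)
    (f : LTwo G) : twistedTranslation σ a (twistedTranslation σ b f)
      = (σ a b : ℂ) • twistedTranslation σ (a + b) f := by
  apply lp.ext
  funext γ
  have h := σ.cocycle a b (-b + (-a + γ))
  rw [add_neg_cancel_left] at h
  simp only [twistedTranslation_apply, lp.coeFn_smul, Pi.smul_apply, smul_eq_mul, neg_add_rev,
    add_assoc]
  rw [← mul_assoc, ← mul_assoc]
  congr 1
  exact_mod_cast (congrArg Circle.coeHom h).symm

theorem twistedTranslation_surjective {G : Type u} [AddGroup G] (σ : Multiplier G) (a : G) :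
    Function.Surjective (twistedTranslation σ a) := by
  intro f
  have h0 : twistedTranslation σ 0 f = f := by
    apply lp.ext; funext γ; simp [σ.zero_left]
  refine ⟨(σ a (-a) : ℂ)⁻¹ • twistedTranslation σ (-a) f, ?_⟩
  rw [map_smul, twistedTranslation_mul, add_neg_cancel, h0, smul_smul,
    inv_mul_cancel₀ (Circle.coe_ne_zero _), one_smul]

/-- The left `σ`-regular representation of `G` on `ℓ²(G)`:
`(λ_σ(a) f)(γ) = σ(a, -a + γ) f(-a + γ)`. -/
noncomputable def regularProjRep {G : Type u} [AddGroup G] (σ : Multiplier G) : ProjRep σ where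
  space := LTwo G
  nontrivial := by
    classical
    exact ⟨0, lp.single 2 (0 : G) (1 : ℂ), fun h => by
      have := congrArg (fun f : LTwo G => f 0) h
      simp at this⟩
  W a := (twistedTranslation σ a).toContinuousLinearMap
  unitary a := (Unitary.linearIsometryEquiv.symm
    (LinearIsometryEquiv.ofSurjective (twistedTranslation σ a)
      (twistedTranslation_surjective σ a))).2
  mul a b := ContinuousLinearMap.ext fun f => twistedTranslation_mul σ a b f

/-- The left `σ`-regular representation `λ_σ` of `C*(G, σ)` on `ℓ²(G)`. -/
noncomputable def regularRep {G : Type u} [AddGroup G] (σ : Multiplier G) :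
    TwistedGroupCStar σ →⋆ₐ[ℂ] (LTwo G →L[ℂ] LTwo G) :=
  TwistedGroupCStar.repOf (regularProjRep σ)

/-- The regular representation is the integrated form of the twisted translations:
`(λ_σ(f) g)(γ) = ∑_a σ(a, -a + γ) f(a) g(-a + γ)` for finitely supported `f`. -/
theorem regularRep_ofFinsupp {G : Type u} [AddGroup G] (σ : Multiplier G) (f : G →₀ ℂ)
    (g : LTwo G) (γ : G) :
    (regularRep σ (TwistedGroupCStar.ofFinsupp σ f) g) γ
      = f.sum fun a c => (σ a (-a + γ) : ℂ) * c * g (-a + γ) := by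
  induction f using Finsupp.induction_linear with
  | zero => simp
  | add f₁ f₂ h₁ h₂ =>
    rw [map_add, map_add, add_apply, lp.coeFn_add, Pi.add_apply, h₁, h₂,
      Finsupp.sum_add_index' (by simp) (by intros; ring)]
  | single a c =>
    rw [Finsupp.sum_single_index (by simp)]
    simp only [TwistedGroupCStar.ofFinsupp, Finsupp.linearCombination_single, map_smul]
    change c * ((σ a (-a + γ) : ℂ) * g (-a + γ)) = _
    ring

end LTwo

/-! ## Noncommutative solenoids and rotation algebras -/

section Solenoid

variable (p : ℕ) [hp : Fact p.Prime]

/-- The additive group `ℤ[1/p] = {a / p^k | a ∈ ℤ, k ∈ ℕ} ⊆ ℚ`. -/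
def zInv : AddSubgroup ℚ where
  carrier := {r | ∃ (a : ℤ) (k : ℕ), r = a / (p : ℚ) ^ k}
  zero_mem' := ⟨0, 0, by simp⟩
  neg_mem' := by
    rintro _ ⟨a, k, rfl⟩
    exact ⟨-a, k, by push_cast; ring⟩
  add_mem' := by
    have hp0 : (p : ℚ) ≠ 0 := Nat.cast_ne_zero.2 hp.out.ne_zero
    rintro _ _ ⟨a, k, rfl⟩ ⟨b, l, rfl⟩
    exact ⟨a * p ^ l + b * p ^ k, k + l, by push_cast; field_simp; ring⟩

/-- The group `Γ = ℤ[1/p] × ℤ[1/p]`. -/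
abbrev solenoidGroup : Type := zInv p × zInv p

/-- The subgroup `Γ_n = p⁻ⁿℤ × p⁻ⁿℤ` of `Γ`. -/
def subgroupAt (n : ℕ) : AddSubgroup (solenoidGroup p) where
  carrier := {γ | ∃ a b : ℤ, (γ.1 : ℚ) = a / (p : ℚ) ^ n ∧ (γ.2 : ℚ) = b / (p : ℚ) ^ n}
  zero_mem' := ⟨0, 0, by simp, by simp⟩
  neg_mem' := by
    rintro γ ⟨a, b, h1, h2⟩
    exact ⟨-a, -b, by simp [h1, neg_div], by simp [h2, neg_div]⟩
  add_mem' := by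
    rintro γ η ⟨a, b, h1, h2⟩ ⟨c, d, h3, h4⟩
    exact ⟨a + c, b + d, by simp [h1, h3, add_div], by simp [h2, h4, add_div]⟩

theorem subgroupAt_mono {j k : ℕ} (h : j ≤ k) : subgroupAt p j ≤ subgroupAt p k := by
  have hp0 : (p : ℚ) ≠ 0 := Nat.cast_ne_zero.2 hp.out.ne_zero
  rintro γ ⟨a, b, h1, h2⟩
  obtain ⟨d, rfl⟩ := Nat.exists_eq_add_of_le h
  refine ⟨a * p ^ d, b * p ^ d, ?_, ?_⟩
  · rw [h1]; push_cast; field_simp; ring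
  · rw [h2]; push_cast; field_simp; ring

/-- The homomorphism `ℤ² → Γ_n`, `(z₁, z₂) ↦ (z₁/pⁿ, z₂/pⁿ)`. -/
def latticeHom (n : ℕ) : ℤ × ℤ →+ subgroupAt p n where
  toFun z := ⟨(⟨z.1 / (p : ℚ) ^ n, z.1, n, rfl⟩, ⟨z.2 / (p : ℚ) ^ n, z.2, n, rfl⟩),
    z.1, z.2, rfl, rfl⟩
  map_zero' := by
    apply Subtype.ext; apply Prod.ext <;> apply Subtype.ext <;> simp
  map_add' z y := by
    apply Subtype.ext; apply Prod.ext <;> apply Subtype.ext <;> simp [add_div]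

theorem latticeHom_bijective (n : ℕ) : Function.Bijective (latticeHom p n) := by
  have hp0 : (p : ℚ) ^ n ≠ 0 := pow_ne_zero _ (Nat.cast_ne_zero.2 hp.out.ne_zero)
  constructor
  · intro z y h
    have h1 : (z.1 : ℚ) / (p : ℚ) ^ n = y.1 / (p : ℚ) ^ n :=
      congrArg (fun γ : subgroupAt p n => ((γ : solenoidGroup p).1 : ℚ)) h
    have h2 : (z.2 : ℚ) / (p : ℚ) ^ n = y.2 / (p : ℚ) ^ n :=
      congrArg (fun γ : subgroupAt p n => ((γ : solenoidGroup p).2 : ℚ)) h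
    rw [div_left_inj' hp0] at h1 h2
    exact Prod.ext (by exact_mod_cast h1) (by exact_mod_cast h2)
  · rintro ⟨γ, a, b, h1, h2⟩
    refine ⟨(a, b), Subtype.ext (Prod.ext (Subtype.ext ?_) (Subtype.ext ?_))⟩
    · exact h1.symm
    · exact h2.symm

/-- The isomorphism `ℤ² ≅ Γ_n`, `(z₁, z₂) ↦ (z₁/pⁿ, z₂/pⁿ)`. -/
noncomputable def latticeEquiv (n : ℕ) : ℤ × ℤ ≃+ subgroupAt p n :=
  AddEquiv.ofBijective (latticeHom p n) (latticeHom_bijective p n)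

/-- The space `Ω_p` of sequences `θ` in `[0,1)` with `p θ_{n+1} = θ_n mod ℤ`. -/
def Omega : Set (ℕ → ℝ) :=
  {θ | (∀ n, 0 ≤ θ n ∧ θ n < 1) ∧ ∀ n, ∃ m : ℤ, p * θ (n + 1) = θ n + m}

variable {p}

/-- The value `exp(2πi θ_{k+l} q t)` for `r = q/p^k` and `s = t/p^l`, for some choice of these
fractions (`pairing_eq` shows that the choice is irrelevant). -/
noncomputable def pairing (θ : Omega p) (r s : zInv p) : Circle :=
  Circle.exp (2 * Real.pi * θ.1 (r.2.choose_spec.choose + s.2.choose_spec.choose)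
    * r.2.choose * s.2.choose)

theorem exp_theta_succ (θ : Omega p) (n : ℕ) (a : ℤ) :
    Circle.exp (2 * Real.pi * θ.1 (n + 1) * (a * p)) = Circle.exp (2 * Real.pi * θ.1 n * a) := by
  obtain ⟨m, hm⟩ := θ.2.2 n
  have h : 2 * Real.pi * θ.1 (n + 1) * (a * p)
      = 2 * Real.pi * θ.1 n * a + ((m * a : ℤ) : ℝ) * (2 * Real.pi) := by
    push_cast
    linear_combination (2 * Real.pi * a) * hm
  rw [h, Circle.exp_add, Circle.exp_intCast_mul, Circle.exp_two_pi, one_zpow, mul_one]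

theorem exp_theta_add (θ : Omega p) (n d : ℕ) (a : ℤ) :
    Circle.exp (2 * Real.pi * θ.1 (n + d) * (a * p ^ d))
      = Circle.exp (2 * Real.pi * θ.1 n * a) := by
  induction d with
  | zero => simp
  | succ d ih =>
    rw [← ih, ← add_assoc]
    have h := exp_theta_succ θ (n + d) (a * p ^ d)
    push_cast at h
    rw [← h, pow_succ, mul_assoc (a : ℝ)]

theorem exp_theta_congr (θ : Omega p) {q q' t : ℤ} {k k' l : ℕ}
    (h : (q : ℚ) / (p : ℚ) ^ k = q' / (p : ℚ) ^ k') :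
    Circle.exp (2 * Real.pi * θ.1 (k + l) * q * t)
      = Circle.exp (2 * Real.pi * θ.1 (k' + l) * q' * t) := by
  have hp0 : (p : ℚ) ≠ 0 := Nat.cast_ne_zero.2 hp.out.ne_zero
  rw [div_eq_div_iff (pow_ne_zero _ hp0) (pow_ne_zero _ hp0)] at h
  have h' : (q : ℝ) * p ^ k' = q' * p ^ k := by exact_mod_cast h
  have h1 := exp_theta_add θ (k + l) k' (q * t)
  have h2 := exp_theta_add θ (k' + l) k (q' * t)
  push_cast at h1 h2
  rw [mul_assoc _ (q : ℝ), mul_assoc _ (q' : ℝ), ← h1, ← h2]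
  have e : k + l + k' = k' + l + k := by omega
  rw [e]
  congr 1
  linear_combination (2 * Real.pi * θ.1 (k' + l + k) * t) * h'

/-- `pairing` is given by `exp(2πi θ_{k+l} q t)` on `(q/p^k, t/p^l)`, for all representations of the
two arguments as fractions. -/
theorem pairing_eq (θ : Omega p) (r s : zInv p) {q t : ℤ} {k l : ℕ}
    (hr : (r : ℚ) = q / (p : ℚ) ^ k) (hs : (s : ℚ) = t / (p : ℚ) ^ l) :
    pairing θ r s = Circle.exp (2 * Real.pi * θ.1 (k + l) * q * t) := by
  have h1 := r.2.choose_spec.choose_spec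
  have h2 := s.2.choose_spec.choose_spec
  unfold pairing
  rw [exp_theta_congr θ (h1.symm.trans hr)]
  have h3 := exp_theta_congr θ (t := q) (l := k) (h2.symm.trans hs)
  rw [add_comm k, mul_right_comm, h3, add_comm k, mul_right_comm]

theorem pairing_add_left (θ : Omega p) (r r' s : zInv p) :
    pairing θ (r + r') s = pairing θ r s * pairing θ r' s := by
  have hp0 : (p : ℚ) ≠ 0 := Nat.cast_ne_zero.2 hp.out.ne_zero
  obtain ⟨a, k, ha⟩ := r.2
  obtain ⟨b, l, hb⟩ := r'.2
  obtain ⟨t, m, ht⟩ := s.2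
  have ha' : (r : ℚ) = ((a * p ^ l : ℤ) : ℚ) / (p : ℚ) ^ (k + l) := by
    rw [ha]; push_cast; field_simp
    try ring
  have hb' : (r' : ℚ) = ((b * p ^ k : ℤ) : ℚ) / (p : ℚ) ^ (k + l) := by
    rw [hb]; push_cast; field_simp
    try ring
  have hab : ((r + r' : zInv p) : ℚ) = ((a * p ^ l + b * p ^ k : ℤ) : ℚ) / (p : ℚ) ^ (k + l) := by
    rw [AddSubgroup.coe_add, ha', hb', ← add_div]; push_cast; rfl
  rw [pairing_eq θ _ _ hab ht, pairing_eq θ _ _ ha' ht, pairing_eq θ _ _ hb' ht, ← Circle.exp_add]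
  congr 1
  push_cast
  ring

theorem pairing_swap (θ : Omega p) (r s : zInv p) : pairing θ r s = pairing θ s r := by
  obtain ⟨a, k, ha⟩ := r.2
  obtain ⟨t, m, ht⟩ := s.2
  rw [pairing_eq θ _ _ ha ht, pairing_eq θ _ _ ht ha, add_comm k, mul_right_comm]

theorem pairing_add_right (θ : Omega p) (r s s' : zInv p) :
    pairing θ r (s + s') = pairing θ r s * pairing θ r s' := by
  rw [pairing_swap, pairing_add_left, pairing_swap θ s, pairing_swap θ s']

theorem pairing_zero_left (θ : Omega p) (s : zInv p) : pairing θ 0 s = 1 := by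
  have h := pairing_add_left θ 0 0 s
  rw [add_zero] at h
  exact left_eq_mul.1 h

/-- The multiplier `σ_θ((q₁/p^{k₁}, q₂/p^{k₂}), (q₃/p^{k₃}, q₄/p^{k₄})) = exp(2πi θ_{k₁+k₄} q₁ q₄)`
on `Γ`, for `θ ∈ Ω_p`. -/
noncomputable def solenoidMultiplier (θ : Omega p) : Multiplier (solenoidGroup p) where
  toFun x y := pairing θ x.1 y.2
  cocycle a b c := by
    simp only [Prod.fst_add, Prod.snd_add, pairing_add_left, pairing_add_right]
    exact (mul_assoc _ _ _).symm.trans (by ac_rfl)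
  zero_left a := pairing_zero_left θ _
  zero_right a := by rw [pairing_swap]; exact pairing_zero_left θ _

/-- The restriction `(σ_θ)_n` of `σ_θ` to `Γ_n`. -/
noncomputable def restrictedMultiplier (θ : Omega p) (n : ℕ) : Multiplier (subgroupAt p n) :=
  (solenoidMultiplier θ).comap (subgroupAt p n).subtype

/-- The multiplier `σ_θ(z, y) = exp(πi θ (z₁ y₂ - z₂ y₁))` on `ℤ²`, for `θ ∈ ℝ`. -/
noncomputable def rotationMultiplier (θ : ℝ) : Multiplier (ℤ × ℤ) where
  toFun z y := Circle.exp (Real.pi * θ * (z.1 * y.2 - z.2 * y.1))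
  cocycle a b c := by
    rw [← Circle.exp_add, ← Circle.exp_add]
    congr 1
    simp only [Prod.fst_add, Prod.snd_add]
    push_cast
    ring
  zero_left a := by simp
  zero_right a := by simp

/-- The noncommutative solenoid `C*(Γ, σ_θ)`. -/
abbrev SolenoidAlgebra (θ : Omega p) : Type 1 := TwistedGroupCStar (solenoidMultiplier θ)

/-- The rotation algebra `C*(ℤ², σ_{θ_{2n}})`. -/
abbrev RotationAlgebra (θ : Omega p) (n : ℕ) : Type 1 :=
  TwistedGroupCStar (rotationMultiplier (θ.1 (2 * n)))

theorem upsilon_compat (θ : Omega p) (n : ℕ) (z y : ℤ × ℤ) :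
    rotationMultiplier (θ.1 (2 * n)) z y
        * Circle.exp (Real.pi * θ.1 (2 * n) * ((z + y).1 * (z + y).2))
      = Circle.exp (Real.pi * θ.1 (2 * n) * (z.1 * z.2))
        * Circle.exp (Real.pi * θ.1 (2 * n) * (y.1 * y.2))
        * restrictedMultiplier θ n (latticeEquiv p n z) (latticeEquiv p n y) := by
  have h : restrictedMultiplier θ n (latticeEquiv p n z) (latticeEquiv p n y)
      = Circle.exp (2 * Real.pi * θ.1 (n + n) * z.1 * y.2) :=
    pairing_eq θ (latticeEquiv p n z : solenoidGroup p).1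
      (latticeEquiv p n y : solenoidGroup p).2 rfl rfl
  rw [h, ← two_mul n]
  simp only [rotationMultiplier, ← Circle.exp_add]
  congr 1
  simp only [Prod.fst_add, Prod.snd_add]
  push_cast
  ring

/-- The `*`-isomorphism `υ_n : C*(ℤ², σ_{θ_{2n}}) ≅ C*(Γ_n, (σ_θ)_n)` mapping the generators
`δ_{(1,0)}` and `δ_{(0,1)}` to `δ_{(p⁻ⁿ,0)}` and `δ_{(0,p⁻ⁿ)}`. -/
noncomputable def upsilon (θ : Omega p) (n : ℕ) :
    RotationAlgebra θ n ≃⋆ₐ[ℂ] TwistedGroupCStar (restrictedMultiplier θ n) :=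
  TwistedGroupCStar.mapEquiv (latticeEquiv p n)
    (fun z => Circle.exp (Real.pi * θ.1 (2 * n) * (z.1 * z.2))) (upsilon_compat θ n)

theorem upsilon_generators (θ : Omega p) (n : ℕ) :
    upsilon θ n (TwistedGroupCStar.delta _ (1, 0))
        = TwistedGroupCStar.delta _ (latticeEquiv p n (1, 0)) ∧
      upsilon θ n (TwistedGroupCStar.delta _ (0, 1))
        = TwistedGroupCStar.delta _ (latticeEquiv p n (0, 1)) := by
  constructor <;> simp [upsilon]

/-- The `*`-homomorphism `β_{j,k} : C*(Γ_j, (σ_θ)_j) → C*(Γ_k, (σ_θ)_k)` induced by the inclusion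
`Γ_j ⊆ Γ_k`. -/
noncomputable def beta (θ : Omega p) (j k : ℕ) (h : j ≤ k) :
    TwistedGroupCStar (restrictedMultiplier θ j) →⋆ₐ[ℂ]
      TwistedGroupCStar (restrictedMultiplier θ k) :=
  TwistedGroupCStar.map (AddSubgroup.inclusion (subgroupAt_mono p h)) (fun _ => 1)
    (fun x y => by rw [mul_one, mul_one, one_mul]; rfl)

/-- The `*`-homomorphism `β_j : C*(Γ_j, (σ_θ)_j) → C*(Γ, σ_θ)` induced by the inclusion
`Γ_j ⊆ Γ`. -/
noncomputable def betaLim (θ : Omega p) (j : ℕ) :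
    TwistedGroupCStar (restrictedMultiplier θ j) →⋆ₐ[ℂ] SolenoidAlgebra θ :=
  TwistedGroupCStar.map (subgroupAt p j).subtype (fun _ => 1)
    (fun x y => by rw [mul_one, mul_one, one_mul]; rfl)

/-- The connecting map `φ_{j,k} = υ_k⁻¹ ∘ β_{j,k} ∘ υ_j`. -/
noncomputable def phi (θ : Omega p) (j k : ℕ) (h : j ≤ k) :
    RotationAlgebra θ j →⋆ₐ[ℂ] RotationAlgebra θ k :=
  ((upsilon θ k).symm : _ →⋆ₐ[ℂ] RotationAlgebra θ k).comp
    ((beta θ j k h).comp (upsilon θ j : RotationAlgebra θ j →⋆ₐ[ℂ] _))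

/-- The canonical map `φ_j = β_j ∘ υ_j` into the noncommutative solenoid. -/
noncomputable def phiLim (θ : Omega p) (j : ℕ) : RotationAlgebra θ j →⋆ₐ[ℂ] SolenoidAlgebra θ :=
  (betaLim θ j).comp (upsilon θ j : RotationAlgebra θ j →⋆ₐ[ℂ] _)

variable (p)

/-- The inclusion `I_{j,k} : ℓ²(Γ_j) → ℓ²(Γ_k)`. -/
noncomputable def inclusionMap (j k : ℕ) (h : j ≤ k) :
    LTwo (subgroupAt p j) →L[ℂ] LTwo (subgroupAt p k) :=
  (extendIsometry (AddSubgroup.inclusion (subgroupAt_mono p h))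
    (AddSubgroup.inclusion_injective _)).toContinuousLinearMap

/-- The inclusion `I_j : ℓ²(Γ_j) → ℓ²(Γ)`. -/
noncomputable def inclusionMapLim (j : ℕ) :
    LTwo (subgroupAt p j) →L[ℂ] LTwo (solenoidGroup p) :=
  (extendIsometry (subgroupAt p j).subtype Subtype.val_injective).toContinuousLinearMap

/-- The length function `L_p(r) = |r| + ‖r‖_p` on `ℤ[1/p]`. -/
def baseLength (r : zInv p) : ℝ := |((r : ℚ) : ℝ)| + (padicNorm p r : ℝ)

/-- The length function `L_p^Σ(r, s) = L_p(r) + L_p(s)` on `Γ`. -/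
def solenoidLength (γ : solenoidGroup p) : ℝ := baseLength p γ.1 + baseLength p γ.2

variable {p}

/-- The triple `(C*(Γ, σ_θ), ℓ²(Γ), 𝒟_p)` on the noncommutative solenoid: the regular
representation, the operator of multiplication by `L_p^Σ`, and the subalgebra `C_C(Γ, σ_θ)`. -/
noncomputable def solenoidTriple (θ : Omega p) :
    TripleData (SolenoidAlgebra θ) (LTwo (solenoidGroup p)) where
  rep := regularRep (solenoidMultiplier θ)
  dirac := mulOperator (solenoidLength p)
  smooth := TwistedGroupCStar.finitelySupported (solenoidMultiplier θ)

/-- The triple `(C*(ℤ², σ_{θ_{2j}}), ℓ²(Γ_j), D_{p,j})` on the rotation algebra: the representation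
`π_{θ_{2j}} = λ_{(σ_θ)_j} ∘ υ_j`, the operator of multiplication by the restriction of `L_p^Σ` to
`Γ_j`, and the subalgebra `C_C(ℤ², σ_{θ_{2j}})`. -/
noncomputable def rotationTriple (θ : Omega p) (j : ℕ) :
    TripleData (RotationAlgebra θ j) (LTwo (subgroupAt p j)) where
  rep := (regularRep (restrictedMultiplier θ j)).comp
    (upsilon θ j : RotationAlgebra θ j →⋆ₐ[ℂ] _)
  dirac := mulOperator fun γ => solenoidLength p γ
  smooth := TwistedGroupCStar.finitelySupported (rotationMultiplier (θ.1 (2 * j)))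

end Solenoid

end NCSolenoid

/-! Every Dirac operator here is multiplication by a length function `L`, so its analysis is
pointwise. Such an operator is self-adjoint on its maximal domain, and its resolvent is
multiplication by `(L - z)⁻¹`, which is compact as soon as `L` is proper. Properness comes from
combining the two absolute values on `ℤ[1/p]`: a bound on `‖r‖_p` bounds the denominator of `r`, and
a bound on `|r|` then bounds its numerator. The triangle inequality gives `|L(a + γ) - L γ| ≤ L a`,
so translations, and hence finitely supported elements, have bounded commutators with multiplication
by `L`.

The deeper point is that the regular representation is faithful on the full twisted algebra
(`norm_le_norm_regularRep`), that is, abelian groups are amenable. Polynomial growth proves it: on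
functions supported in a finite set `B` the full norm is at most `√|B|` times the reduced norm. For
`y = x⋆x` with finite support, the support of `y ^ N` grows polynomially in `N`, and comparing `‖y‖
^ N = ‖y ^ N‖` for `N = 2 ^ m` removes the polynomial factor. Faithfulness also makes the maps
induced by subgroup inclusions injective (`map_injective`).

Since `Γ` is the increasing union of the `Γ_j`, finitely supported elements and vectors already live
at a finite stage. This gives the algebraic and Hilbert space limits, and the finitely supported
vectors form a core for the limit operator (`closure_eq_mulOperator`). The resolvents at stage `j`
differ from the limit resolvent only off `Γ_j`, where `(L - z)⁻¹` is eventually uniformly small.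
Commutators at every stage are restrictions of one commutator on `ℓ²(Γ)`, so they share its bound.
-/

namespace NCSolenoid

/-! ### Bounded and compact diagonal operators on `ℓ²` -/

section DiagonalOperators

variable {X : Type u}

theorem LTwo.norm_le_of_pointwise {f g : LTwo X} {C : ℝ} (hC : 0 ≤ C)
    (h : ∀ x, ‖f x‖ ≤ C * ‖g x‖) : ‖f‖ ≤ C * ‖g‖ := by
  have h1 : ‖f‖ ≤ ‖(C : ℂ) • g‖ := by
    refine lp.norm_mono two_ne_zero fun x => ?_
    rw [lp.coeFn_smul, Pi.smul_apply, norm_smul, Complex.norm_of_nonneg hC]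
    exact h x
  rwa [norm_smul, Complex.norm_of_nonneg hC] at h1

theorem LTwo.opNorm_le_of_pointwise (T : LTwo X →L[ℂ] LTwo X) {C : ℝ} (hC : 0 ≤ C)
    (h : ∀ f x, ‖T f x‖ ≤ C * ‖f x‖) : ‖T‖ ≤ C :=
  T.opNorm_le_bound hC fun f => LTwo.norm_le_of_pointwise hC (h f)

/-- The bounded operator of pointwise multiplication by a bounded function. -/
noncomputable def diagOperator (m : X → ℂ) (C : ℝ) (hm : ∀ x, ‖m x‖ ≤ C) :
    LTwo X →L[ℂ] LTwo X :=
  -- When `X` is empty, `hm` does not force `C` to be nonnegative; `|C|` covers that case.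
  have hC (f : LTwo X) (x : X) : ‖m x * f x‖ ≤ ‖((|C| : ℝ) : ℂ) * f x‖ := by
    rw [norm_mul, norm_mul]
    gcongr
    simpa using (hm x).trans (le_abs_self C)
  LinearMap.mkContinuous
    { toFun := fun f => ⟨fun x => m x * f x,
        Memℓp.mono' (Memℓp.const_smul (lp.memℓp f) ((|C| : ℝ) : ℂ)) (hC f)⟩
      map_add' := fun f g => by
        apply lp.ext; funext x
        exact mul_add _ _ _
      map_smul' := fun c f => by
        apply lp.ext; funext x
        exact mul_left_comm _ _ _ } |C|
    fun f => LTwo.norm_le_of_pointwise (abs_nonneg C) fun x => by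
      simpa using hC f x

@[simp] theorem diagOperator_apply (m : X → ℂ) (C : ℝ) (hm : ∀ x, ‖m x‖ ≤ C) (f : LTwo X) (x : X) :
    diagOperator m C hm f x = m x * f x := rfl

/-- A bounded diagonal operator whose entries tend to zero is compact. -/
theorem isCompactOperator_of_diagonal (R : LTwo X →L[ℂ] LTwo X) (m : X → ℂ)
    (hR : ∀ f x, R f x = m x * f x) (hm : Filter.Tendsto m Filter.cofinite (nhds 0)) :
    IsCompactOperator R := by
  classical
  -- `F s` is the finite-rank truncation of `R` to the coordinates in `s`; compactness passes to the
  -- norm limit.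
  let F : Finset X → (LTwo X →L[ℂ] LTwo X) := fun s =>
    ∑ x ∈ s, m x • (lp.singleContinuousLinearMap ℂ (fun _ : X => ℂ) 2 x ∘L
      lp.evalCLM ℂ (fun _ : X => ℂ) 2 x)
  have hF : ∀ s f y, F s f y = if y ∈ s then m y * f y else 0 := by
    intro s f y
    simp only [F, sum_apply, lp.coeFn_sum, Finset.sum_apply,
      smul_apply, ContinuousLinearMap.comp_apply, lp.coeFn_smul, Pi.smul_apply,
      lp.singleContinuousLinearMap_apply, lp.single_apply, smul_eq_mul]
    rw [← Finset.sum_ite_eq s y (fun x => m x * f x)]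
    refine Finset.sum_congr rfl fun x _ => ?_
    by_cases h : y = x
    · subst h
      simp only [Pi.single_eq_same, if_true]
      rfl
    · simp [h]
  refine isCompactOperator_of_tendsto (l := Filter.atTop) (F := F) ?_ (.of_forall fun s => ?_)
  · rw [Metric.tendsto_atTop]
    intro ε hε
    -- Once `s` contains the finitely many entries of size at least `ε / 2`, the error `F s - R` is
    -- diagonal with entries below `ε / 2`.
    have h1 : {x | ¬ ‖m x‖ < ε / 2}.Finite := by
      have := hm.norm.eventually
        (Iio_mem_nhds (show ‖(0 : ℂ)‖ < ε / 2 by simpa using hε))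
      exact Filter.eventually_cofinite.1 this
    refine ⟨h1.toFinset, fun s hs => ?_⟩
    rw [dist_eq_norm]
    refine lt_of_le_of_lt (LTwo.opNorm_le_of_pointwise _ (half_pos hε).le fun f x => ?_)
      (half_lt_self hε)
    rw [sub_apply, lp.coeFn_sub, Pi.sub_apply, hF, hR]
    split_ifs with hx
    · simpa using mul_nonneg (half_pos hε).le (norm_nonneg _)
    · rw [zero_sub, norm_neg, norm_mul]
      gcongr
      by_contra hlt
      exact hx (hs (by simpa using fun h : ‖m x‖ < ε / 2 => hlt h.le))
  · induction s using Finset.induction_on with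
    | empty => exact isCompactOperator_zero
    | insert x s hx ih =>
      have h : F (insert x s) = m x • (lp.singleContinuousLinearMap ℂ (fun _ : X => ℂ) 2 x ∘L
          lp.evalCLM ℂ (fun _ : X => ℂ) 2 x) + F s := Finset.sum_insert hx
      rw [h]
      have he : IsCompactOperator (lp.evalCLM ℂ (fun _ : X => ℂ) 2 x) :=
        isCompactOperator_of_locallyCompactSpace_dom (lp.evalCLM ℂ (fun _ : X => ℂ) 2 x)
      exact ((he.clm_comp (lp.singleContinuousLinearMap ℂ (fun _ : X => ℂ) 2 x)).smul (m x)).add ih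

end DiagonalOperators

/-! ### Unbounded multiplication operators: self-adjointness and resolvents -/

section MulOperator

variable {X : Type u} (L : X → ℝ)

@[simp] theorem mulOperator_apply (f : (mulOperator L).domain) (x : X) :
    mulOperator L f x = (L x : ℂ) * (f : LTwo X) x := rfl

theorem mem_mulOperator_domain {f : LTwo X} :
    f ∈ (mulOperator L).domain ↔ Memℓp (fun x => (L x : ℂ) * f x) 2 := Iff.rfl

/-- Exhibiting the image vector `g` as an element of `ℓ²` replaces a summability estimate in the
later domain arguments. -/
theorem mem_mulOperator_domain_of_eq {f g : LTwo X} (h : ∀ x, g x = (L x : ℂ) * f x) :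
    f ∈ (mulOperator L).domain := by
  rw [mem_mulOperator_domain, ← funext h]
  exact lp.memℓp g

theorem single_mem_mulOperator_domain [DecidableEq X] (x : X) (c : ℂ) :
    lp.single 2 x c ∈ (mulOperator L).domain :=
  mem_mulOperator_domain_of_eq L (g := lp.single 2 x (L x * c)) fun y => by
    rw [lp.single_apply, lp.single_apply]
    by_cases h : y = x
    · subst h; simp
    · simp [h]

theorem mulOperator_single [DecidableEq X] (x : X) (c : ℂ) :
    mulOperator L ⟨lp.single 2 x c, single_mem_mulOperator_domain L x c⟩
      = (L x : ℂ) • lp.single 2 x c := by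
  refine lp.ext (funext fun y => ?_)
  rw [mulOperator_apply, lp.coeFn_smul, Pi.smul_apply, smul_eq_mul, lp.single_apply]
  by_cases h : y = x
  · subst h; simp
  · simp [h]

theorem dense_of_single_mem [DecidableEq X] (S : Submodule ℂ (LTwo X))
    (h : ∀ x c, lp.single 2 x c ∈ S) : Dense (S : Set (LTwo X)) := fun f =>
  mem_closure_of_tendsto (lp.hasSum_single ENNReal.ofNat_ne_top f)
    (.of_forall fun _ => S.sum_mem fun x _ => h x _)

theorem dense_mulOperator_domain : Dense ((mulOperator L).domain : Set (LTwo X)) := by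
  classical
  exact dense_of_single_mem _ (single_mem_mulOperator_domain L)

/-- Symmetry holds because `L` is real. Conversely, pairing with basis vectors shows that the
adjoint acts on `g` as pointwise multiplication by `L`, so `L g` is in `ℓ²` and `g` already belongs
to the maximal domain. -/
theorem isSelfAdjoint_mulOperator : IsSelfAdjoint (mulOperator L) := by
  classical
  have hd := dense_mulOperator_domain L
  have hsymm : (mulOperator L).IsFormalAdjoint (mulOperator L) := by
    intro f g
    rw [lp.inner_eq_tsum, lp.inner_eq_tsum]
    refine tsum_congr fun x => ?_
    simp only [mulOperator_apply, RCLike.inner_apply, map_mul, Complex.conj_ofReal]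
    ring
  rw [LinearPMap.isSelfAdjoint_def]
  refine le_antisymm ?_ (hsymm.le_adjoint hd)
  have key : ∀ (g : (LinearPMap.adjoint (mulOperator L)).domain) (x : X),
      LinearPMap.adjoint (mulOperator L) g x = (L x : ℂ) * (g : LTwo X) x := by
    intro g x
    have h := LinearPMap.adjoint_isFormalAdjoint hd g
      ⟨lp.single 2 x 1, single_mem_mulOperator_domain L x 1⟩
    rw [mulOperator_single, inner_smul_right, lp.inner_single_right, lp.inner_single_right] at h
    have h' := congrArg (starRingEnd ℂ) h
    simpa using h'
  refine ⟨fun g hg => mem_mulOperator_domain_of_eq L (key ⟨g, hg⟩), fun f g hfg => ?_⟩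
  refine lp.ext (funext fun x => ?_)
  rw [key, mulOperator_apply, hfg]

theorem le_norm_ofReal_sub (L : ℝ) (z : ℂ) : |z.im| ≤ ‖(L : ℂ) - z‖ := by
  simpa using Complex.abs_im_le_norm ((L : ℂ) - z)

/-- The resolvent of a multiplication operator at a non-real point. -/
noncomputable def mulResolvent (z : ℂ) (hz : z.im ≠ 0) : LTwo X →L[ℂ] LTwo X :=
  diagOperator (fun x => ((L x : ℂ) - z)⁻¹) |z.im|⁻¹ fun x => by
    rw [norm_inv]
    exact inv_anti₀ (abs_pos.2 hz) (le_norm_ofReal_sub _ _)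

theorem mulResolvent_apply (z : ℂ) (hz : z.im ≠ 0) (f : LTwo X) (x : X) :
    mulResolvent L z hz f x = ((L x : ℂ) - z)⁻¹ * f x := rfl

theorem isResolventAt_mulResolvent (z : ℂ) (hz : z.im ≠ 0) :
    IsResolventAt (mulOperator L) z (mulResolvent L z hz) := by
  have h0 : ∀ x, (L x : ℂ) - z ≠ 0 := fun x h => hz (by
    have := congrArg Complex.im h
    simpa using this)
  -- The identity `L (L - z)⁻¹ f = f + z (L - z)⁻¹ f` displays the image as an `ℓ²` vector.
  have hmem : ∀ f : LTwo X, mulResolvent L z hz f ∈ (mulOperator L).domain := fun f =>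
    mem_mulOperator_domain_of_eq L (g := f + z • mulResolvent L z hz f) fun x => by
      simp only [lp.coeFn_add, lp.coeFn_smul, Pi.add_apply, Pi.smul_apply, mulResolvent_apply,
        smul_eq_mul]
      field_simp [h0 x]
      ring
  refine ⟨hmem, fun f => lp.ext (funext fun x => ?_), fun f => lp.ext (funext fun x => ?_)⟩
  · simp only [lp.coeFn_sub, lp.coeFn_smul, Pi.sub_apply, Pi.smul_apply, mulResolvent_apply,
      smul_eq_mul, mulOperator_apply]
    field_simp [h0 x]
  · simp only [lp.coeFn_sub, lp.coeFn_smul, Pi.sub_apply, Pi.smul_apply, mulResolvent_apply,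
      smul_eq_mul, mulOperator_apply]
    field_simp [h0 x]

/-- The bound `L x - ‖z‖ ≤ ‖L x - z‖` sends the denominators to infinity; points with `L x = z` are
finite in number and do not affect the cofinite limit. -/
theorem tendsto_inv_sub (hL : Filter.Tendsto L Filter.cofinite Filter.atTop) (z : ℂ) :
    Filter.Tendsto (fun x => ((L x : ℂ) - z)⁻¹) Filter.cofinite (nhds 0) := by
  refine Filter.tendsto_inv₀_cobounded.comp ?_
  rw [← tendsto_norm_atTop_iff_cobounded]
  refine Filter.tendsto_atTop_mono (fun x => ?_) (Filter.tendsto_atTop_add_const_right _ (-‖z‖) hL)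
  have h1 := norm_sub_norm_le (L x : ℂ) z
  have h2 := le_abs_self (L x)
  rw [Complex.norm_real, Real.norm_eq_abs] at h1
  linarith

theorem hasCompactResolvent_mulOperator (hL : Filter.Tendsto L Filter.cofinite Filter.atTop) :
    HasCompactResolvent (mulOperator L) := by
  classical
  refine ⟨⟨Complex.I, _, isResolventAt_mulResolvent L Complex.I (by simp)⟩, fun z R hR => ?_⟩
  -- Here `z` may be real and `R` is an arbitrary resolvent; the right inverse property alone forces
  -- `R` to be diagonal.
  have hpt : ∀ f x, ((L x : ℂ) - z) * R f x = f x := fun f x => by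
    have := congrArg (fun g : LTwo X => g x) (hR.right_inv f)
    simp only [lp.coeFn_sub, lp.coeFn_smul, Pi.sub_apply, Pi.smul_apply,
      smul_eq_mul, mulOperator_apply] at this
    rw [sub_mul, this]
  refine isCompactOperator_of_diagonal R _ (fun f x => ?_) (tendsto_inv_sub L hL z)
  -- If `L x = z`, then `hpt` at the basis vector of `x` reads `0 = 1`.
  have h0 : (L x : ℂ) - z ≠ 0 := fun h => by
    have := hpt (lp.single 2 x 1) x
    simp [h] at this
  rw [eq_inv_mul_iff_mul_eq₀ h0, hpt]

end MulOperator

/-! ### Density of the finitely supported elements -/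

section Density

variable {G : Type u} [AddGroup G] (σ : Multiplier G)

open TwistedGroupCStar

theorem continuous_starAlgHom {A B : Type*} [CStarAlgebra A] [CStarAlgebra B] (f : A →⋆ₐ[ℂ] B) :
    Continuous f :=
  AddMonoidHomClass.continuous_of_bound f 1 fun x => by
    simpa using NonUnitalStarAlgHom.norm_apply_le f x

theorem delta_mem_finitelySupported (g : G) : delta σ g ∈ finitelySupported σ :=
  ⟨Finsupp.single g 1, by simp [ofFinsupp]⟩

theorem mem_finitelySupported {x : TwistedGroupCStar σ} :
    x ∈ finitelySupported σ ↔ x ∈ Submodule.span ℂ (Set.range (delta σ)) := by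
  rw [← range_ofFinsupp]
  rfl

/-- The finitely supported elements form a `*`-subalgebra containing the generators, so their image
contains the algebra whose closure defines `C*(G, σ)`; the norm topology is the one induced by
`incl`. -/
theorem dense_finitelySupported : Dense (finitelySupported σ : Set (TwistedGroupCStar σ)) := by
  intro x
  have hle : StarAlgebra.adjoin ℂ (Set.range (universalUnitary σ))
      ≤ (finitelySupported σ).map (incl σ) := by
    refine StarAlgebra.adjoin_le ?_
    rintro _ ⟨g, rfl⟩
    exact ⟨delta σ g, delta_mem_finitelySupported σ g, rfl⟩
  have hind : Topology.IsInducing (incl σ) := ⟨rfl⟩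
  rw [hind.closure_eq_preimage_closure_image]
  exact closure_mono hle x.2

theorem norm_delta_le (g : G) : ‖delta σ g‖ ≤ 1 :=
  lp.norm_le_of_forall_le zero_le_one fun W => W.norm_W_le g

end Density

/-! ### Comparing the full and reduced norms on a finite support -/

section Faithful

open TwistedGroupCStar

variable {G : Type u} [AddGroup G] (σ : Multiplier G)

/-- Only `a = γ` contributes, with coefficient `σ(γ, 0) = 1`. Reading `f` off in this way bounds its
`ℓ²` norm by the reduced norm. -/
theorem regularRep_ofFinsupp_single_zero [DecidableEq G] (f : G →₀ ℂ) (γ : G) :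
    regularRep σ (ofFinsupp σ f) (lp.single 2 (0 : G) (1 : ℂ)) γ = f γ := by
  rw [regularRep_ofFinsupp, Finsupp.sum, Finset.sum_eq_single γ]
  · simp [σ.zero_right]
  · intro a _ ha
    have : -a + γ ≠ 0 := fun h => ha (neg_add_eq_zero.1 h)
    simp [this]
  · intro h
    simp [Finsupp.notMem_support_iff.1 h]

/-- Haagerup-type estimate: on functions supported in a finite set `B`, the enveloping norm is at
most `√|B|` times the reduced norm. -/
theorem norm_ofFinsupp_le (f : G →₀ ℂ) (B : Finset G) (hf : f.support ⊆ B) :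
    ‖ofFinsupp σ f‖ ≤ √(B.card) * ‖regularRep σ (ofFinsupp σ f)‖ := by
  classical
  -- The full norm is at most the `ℓ¹` norm and the reduced norm at least the `ℓ²` norm (`h2`);
  -- Cauchy–Schwarz on `B` costs the factor `√|B|` (`h5`).
  have h1 : ‖ofFinsupp σ f‖ ≤ ∑ a ∈ B, ‖f a‖ := by
    rw [ofFinsupp, Finsupp.linearCombination_apply,
      Finsupp.sum_of_support_subset f hf _ (by simp)]
    refine norm_sum_le_of_le _ fun a _ => ?_
    rw [norm_smul]
    exact mul_le_of_le_one_right (norm_nonneg _) (norm_delta_le σ a)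
  set ξ : LTwo G := lp.single 2 (0 : G) (1 : ℂ) with hξ
  have h2 : ∑ a ∈ B, ‖f a‖ ^ 2 ≤ ‖regularRep σ (ofFinsupp σ f)‖ ^ 2 := by
    have h3 := lp.sum_rpow_le_norm_rpow (p := 2) (by norm_num)
      (regularRep σ (ofFinsupp σ f) ξ) B
    have h4 : ‖regularRep σ (ofFinsupp σ f) ξ‖ ≤ ‖regularRep σ (ofFinsupp σ f)‖ := by
      refine ((regularRep σ (ofFinsupp σ f)).le_opNorm ξ).trans_eq ?_
      rw [hξ, lp.norm_single (by norm_num)]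
      simp
    simp only [hξ, regularRep_ofFinsupp_single_zero, ENNReal.toReal_ofNat, Real.rpow_ofNat] at h3
    exact h3.trans (pow_le_pow_left₀ (norm_nonneg _) h4 2)
  have h5 : (∑ a ∈ B, ‖f a‖) ^ 2 ≤ (√(B.card) * ‖regularRep σ (ofFinsupp σ f)‖) ^ 2 := by
    rw [mul_pow, Real.sq_sqrt (Nat.cast_nonneg _)]
    exact sq_sum_le_card_mul_sum_sq.trans (by gcongr)
  exact h1.trans ((sq_le_sq₀ (by positivity) (by positivity)).1 h5)

end Faithful

/-! ### Amenability of abelian groups through polynomial growth -/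

section Amenability

open TwistedGroupCStar

variable {G : Type u} [AddCommGroup G]

/-- The finite set of sums `∑ k_s s`, `s ∈ S`, with `0 ≤ k_s ≤ n`. -/
def boxSums [DecidableEq G] (S : Finset G) (n : ℕ) : Finset G :=
  (Fintype.piFinset fun _ : S => Finset.range (n + 1)).image fun k : S → ℕ =>
    ∑ s : S, k s • (s : G)

theorem card_boxSums_le [DecidableEq G] (S : Finset G) (n : ℕ) :
    (boxSums S n).card ≤ (n + 1) ^ S.card := by
  refine Finset.card_image_le.trans_eq ?_
  simp

theorem zero_mem_boxSums [DecidableEq G] (S : Finset G) : (0 : G) ∈ boxSums S 0 :=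
  Finset.mem_image.2 ⟨fun _ => 0, by simp, by simp⟩

/-- Commutativity is what makes this work: a further summand `s` merely raises its own multiplicity
by one. -/
theorem add_mem_boxSums [DecidableEq G] {S : Finset G} {n : ℕ} {a s : G} (ha : a ∈ boxSums S n)
    (hs : s ∈ S) : a + s ∈ boxSums S (n + 1) := by
  obtain ⟨k, hk, rfl⟩ := Finset.mem_image.1 ha
  refine Finset.mem_image.2 ⟨k + Pi.single ⟨s, hs⟩ 1, ?_, ?_⟩
  · rw [Fintype.mem_piFinset] at hk ⊢
    intro t
    have h1 := Finset.mem_range.1 (hk t)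
    have h2 : (Pi.single ⟨s, hs⟩ 1 : S → ℕ) t ≤ 1 := by
      rw [Pi.single_apply]; split_ifs <;> simp
    rw [Finset.mem_range, Pi.add_apply]
    omega
  · simp [add_smul, Finset.sum_add_distrib, Pi.single_apply, ite_smul]

/-- The multiplier contributes only scalars, so supports of powers grow exactly as sumsets do, hence
polynomially in `n` by `card_boxSums_le`. -/
theorem pow_mem_span_boxSums [DecidableEq G] (σ : Multiplier G) {S : Finset G}
    {x : TwistedGroupCStar σ} (hx : x ∈ Submodule.span ℂ (delta σ '' S)) (n : ℕ) :
    x ^ n ∈ Submodule.span ℂ (delta σ '' boxSums S n) := by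
  induction n with
  | zero =>
    rw [pow_zero, ← delta_zero]
    exact Submodule.subset_span ⟨0, zero_mem_boxSums S, rfl⟩
  | succ n ih =>
    rw [pow_succ]
    have h := Submodule.mul_mem_mul ih hx
    rw [Submodule.span_mul_span] at h
    refine (Submodule.span_le.2 ?_) h
    rintro _ ⟨_, ⟨a, ha, rfl⟩, _, ⟨s, hs, rfl⟩, rfl⟩
    simp only [delta_mul]
    exact Submodule.smul_mem _ _ (Submodule.subset_span ⟨_, add_mem_boxSums ha hs, rfl⟩)

/-- A polynomial factor cannot compensate exponential decay: if `b < a`, the right side divided by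
`a ^ 2 ^ m` tends to zero. Only exponents `2 ^ m` appear because the C*-identity computes norms of
exactly these powers of a self-adjoint element. -/
theorem le_of_pow_two_pow_le {a b : ℝ} (hb : 0 ≤ b) (k : ℕ)
    (h : ∀ m : ℕ, a ^ 2 ^ m ≤ √((2 ^ m + 1) ^ k) * b ^ 2 ^ m) : a ≤ b := by
  by_contra! hlt
  have ha0 : 0 < a := hb.trans_lt hlt
  have hr : |b / a| < 1 := by
    rw [abs_of_nonneg (by positivity), div_lt_one ha0]
    exact hlt
  have ht := (tendsto_pow_const_mul_const_pow_of_abs_lt_one k hr).const_mul (2 ^ k : ℝ)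
  rw [mul_zero] at ht
  have ht2 := ht.comp (tendsto_pow_atTop_atTop_of_one_lt (one_lt_two : 1 < 2))
  refine absurd (ge_of_tendsto' ht2 fun m => ?_) (not_le.2 one_pos)
  have h1 : (1 : ℝ) ≤ (2 ^ m + 1) ^ k := one_le_pow₀ (by linarith [pow_pos (two_pos (α := ℝ)) m])
  -- Using `√t ≤ t` for `t ≥ 1` and `2 ^ m + 1 ≤ 2 * 2 ^ m` brings the factor to the form `2 ^ k * n
  -- ^ k` with `n = 2 ^ m`, as in `ht`.
  have h2 : √((2 ^ m + 1) ^ k : ℝ) ≤ 2 ^ k * (2 ^ m) ^ k := by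
    calc √((2 ^ m + 1) ^ k : ℝ) ≤ (2 ^ m + 1) ^ k :=
        Real.sqrt_le_iff.2 ⟨by positivity, by nlinarith⟩
      _ ≤ (2 * 2 ^ m) ^ k := by
        gcongr
        linarith [one_le_pow₀ (one_le_two (α := ℝ)) (n := m)]
      _ = _ := mul_pow _ _ _
  have h3 : 1 ≤ √((2 ^ m + 1) ^ k) * (b / a) ^ 2 ^ m := by
    rw [div_pow, ← mul_div_assoc, one_le_div (by positivity)]
    exact h m
  calc (1 : ℝ) ≤ √((2 ^ m + 1) ^ k) * (b / a) ^ 2 ^ m := h3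
    _ ≤ 2 ^ k * (2 ^ m) ^ k * (b / a) ^ 2 ^ m := by gcongr
    _ = _ := by simp [mul_assoc]

theorem norm_star_mul_self_operator {H : Type*} [NormedAddCommGroup H] [InnerProductSpace ℂ H]
    [CompleteSpace H] (T : H →L[ℂ] H) : ‖star T * T‖ = ‖T‖ * ‖T‖ :=
  CStarRing.norm_star_mul_self

/-- Abelian groups are amenable: the enveloping norm equals the reduced norm. -/
theorem norm_le_norm_regularRep (σ : Multiplier G) (x : TwistedGroupCStar σ) :
    ‖x‖ ≤ ‖regularRep σ x‖ := by
  classical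
  have hc := continuous_starAlgHom (regularRep σ)
  refine (dense_finitelySupported σ).induction (P := fun x => ‖x‖ ≤ ‖regularRep σ x‖)
    (fun x hx => ?_) (isClosed_le continuous_norm hc.norm) x
  -- Passing to `y` gives a self-adjoint element, for which `‖y ^ 2 ^ m‖ = ‖y‖ ^ 2 ^ m`; the
  -- C*-identity on both sides returns to `x`.
  set y := star x * x with hy
  obtain ⟨f, hf⟩ : y ∈ finitelySupported σ := mul_mem (star_mem hx) hx
  have hyS : y ∈ Submodule.span ℂ (delta σ '' f.support) :=
    (Finsupp.mem_span_image_iff_linearCombination ℂ).2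
      ⟨f, by simp [Finsupp.mem_supported], hf⟩
  have hsa : IsSelfAdjoint y := IsSelfAdjoint.star_mul_self x
  have key : ‖y‖ ≤ ‖regularRep σ y‖ := by
    -- The growth exponent is the size of the support of `y`, fixed while `m` varies.
    refine le_of_pow_two_pow_le (norm_nonneg _) f.support.card fun m => ?_
    obtain ⟨g, hg, hgy⟩ := (Finsupp.mem_span_image_iff_linearCombination ℂ).1
      (pow_mem_span_boxSums σ hyS (2 ^ m))
    have h1 := norm_ofFinsupp_le σ g _ (by simpa [Finsupp.mem_supported] using hg)
    have hgy' : ofFinsupp σ g = y ^ 2 ^ m := hgy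
    rw [hgy', hsa.norm_pow_two_pow, map_pow] at h1
    refine h1.trans ?_
    gcongr
    · exact_mod_cast card_boxSums_le f.support (2 ^ m)
    · exact norm_pow_le' _ (by positivity)
  have h2 : ‖regularRep σ y‖ = ‖regularRep σ x‖ * ‖regularRep σ x‖ := by
    have h4 : regularRep σ y = star (regularRep σ x) * regularRep σ x := by
      rw [hy, map_mul, map_star]
    exact (congrArg norm h4).trans (norm_star_mul_self_operator _)
  rw [h2, hy, CStarRing.norm_star_mul_self] at key
  exact abs_le_of_sq_le_sq' (by simpa [sq] using key) (norm_nonneg _) |>.2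

theorem regularRep_injective (σ : Multiplier G) : Function.Injective (regularRep σ) := by
  rw [injective_iff_map_eq_zero]
  intro x hx
  have h := norm_le_norm_regularRep σ x
  rw [hx, norm_zero] at h
  exact norm_le_zero_iff.1 h

end Amenability

/-! ### Maps induced by group homomorphisms -/

section Functoriality

open TwistedGroupCStar

variable {G K : Type u} [AddGroup G] [AddGroup K]

theorem extendIsometry_apply {X Y : Type u} (e : X → Y) (he : Function.Injective e)
    (f : LTwo X) (x : X) : extendIsometry e he f (e x) = f x :=
  he.extend_apply _ _ _

theorem extendIsometry_apply_of_notMem {X Y : Type u} (e : X → Y) (he : Function.Injective e)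
    (f : LTwo X) {y : Y} (hy : y ∉ Set.range e) : extendIsometry e he f y = 0 :=
  Function.extend_apply' _ _ _ hy

/-- The range of `h` is a subgroup, so translation by `h a` preserves both it and its complement;
off the range both sides vanish. -/
theorem extendIsometry_twistedTranslation {σ : Multiplier G} {τ : Multiplier K} (h : G →+ K)
    (hi : Function.Injective h) (hστ : ∀ x y, σ x y = τ (h x) (h y)) (a : G) (f : LTwo G) :
    extendIsometry h hi (twistedTranslation σ a f)
      = twistedTranslation τ (h a) (extendIsometry h hi f) := by
  refine lp.ext (funext fun y => ?_)
  rw [twistedTranslation_apply]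
  by_cases hy : y ∈ Set.range h
  · obtain ⟨x, rfl⟩ := hy
    rw [extendIsometry_apply, ← map_neg, ← map_add, extendIsometry_apply,
      twistedTranslation_apply, hστ]
  · rw [extendIsometry_apply_of_notMem _ _ _ hy, extendIsometry_apply_of_notMem _ _ _, mul_zero]
    rintro ⟨x, hx⟩
    exact hy ⟨a + x, by rw [map_add, hx, add_neg_cancel_left]⟩

/-- The regular representations intertwine the map induced by an injective homomorphism. -/
theorem extendIsometry_regularRep {σ : Multiplier G} {τ : Multiplier K} (h : G →+ K)
    (hi : Function.Injective h)
    (hb : ∀ x y, σ x y * (1 : Circle) = 1 * 1 * τ (h x) (h y)) (x : TwistedGroupCStar σ) :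
    (extendIsometry h hi).toContinuousLinearMap ∘L regularRep σ x
      = regularRep τ (TwistedGroupCStar.map h (fun _ => 1) hb x)
        ∘L (extendIsometry h hi).toContinuousLinearMap := by
  have hc := continuous_starAlgHom (regularRep σ)
  have hc' := (continuous_starAlgHom (regularRep τ)).comp
    (continuous_starAlgHom (TwistedGroupCStar.map h (fun _ => 1) hb))
  refine (dense_finitelySupported σ).induction
    (P := fun x => (extendIsometry h hi).toContinuousLinearMap ∘L regularRep σ x
      = regularRep τ (TwistedGroupCStar.map h (fun _ => 1) hb x)
        ∘L (extendIsometry h hi).toContinuousLinearMap)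
    (fun x hx => ?_) (isClosed_eq (continuous_const.clm_comp hc)
      (hc'.clm_comp continuous_const)) x
  rw [SetLike.mem_coe, mem_finitelySupported] at hx
  induction hx using Submodule.span_induction with
  | mem x hx =>
    obtain ⟨a, rfl⟩ := hx
    rw [map_delta, Circle.coe_one, one_smul]
    ext1 f
    exact extendIsometry_twistedTranslation h hi (fun x y => by simpa using hb x y) a f
  | zero => simp
  | add x y _ _ hx hy => simp only [map_add, ContinuousLinearMap.comp_add,
      ContinuousLinearMap.add_comp, hx, hy]
  | smul c x _ hx => simp only [map_smul, ContinuousLinearMap.comp_smul,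
      ContinuousLinearMap.smul_comp, hx]

theorem map_mem_finitelySupported {σ : Multiplier G} {τ : Multiplier K} (h : G →+ K)
    (b : G → Circle) (hb : ∀ x y, σ x y * b (x + y) = b x * b y * τ (h x) (h y))
    {x : TwistedGroupCStar σ} (hx : x ∈ finitelySupported σ) :
    TwistedGroupCStar.map h b hb x ∈ finitelySupported τ := by
  rw [mem_finitelySupported] at hx ⊢
  induction hx using Submodule.span_induction with
  | mem x hx =>
    obtain ⟨a, rfl⟩ := hx
    rw [map_delta]
    exact Submodule.smul_mem _ _ (Submodule.subset_span ⟨_, rfl⟩)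
  | zero => rw [map_zero]; exact Submodule.zero_mem _
  | add x y _ _ hx hy => rw [map_add]; exact Submodule.add_mem _ hx hy
  | smul c x _ hx => rw [map_smul]; exact Submodule.smul_mem _ _ hx

end Functoriality

/-- If `x` is sent to zero, intertwining and injectivity of extension by zero give `regularRep σ x =
0`, and faithfulness for `G` finishes. Amenability of `K` plays no role. -/
theorem map_injective {G K : Type u} [AddCommGroup G] [AddGroup K] {σ : Multiplier G}
    {τ : Multiplier K} (h : G →+ K) (hi : Function.Injective h)
    (hb : ∀ x y, σ x y * (1 : Circle) = 1 * 1 * τ (h x) (h y)) :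
    Function.Injective (TwistedGroupCStar.map h (fun _ => 1) hb) := by
  rw [injective_iff_map_eq_zero]
  intro x hx
  apply regularRep_injective σ
  have h1 := extendIsometry_regularRep h hi hb x
  rw [hx, map_zero, ContinuousLinearMap.zero_comp] at h1
  rw [map_zero]
  ext1 f
  exact (extendIsometry h hi).injective ((DFunLike.congr_fun h1 f).trans (map_zero _).symm)

/-! ### Bounded commutators with multiplication operators -/

section Commutator

open TwistedGroupCStar

variable {G : Type u} [AddGroup G] (σ : Multiplier G) (L : G → ℝ)

/-- For a function `L` with bounded differences, the commutator of multiplication by `L` with a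
finitely supported element is the bounded operator `B`. -/
theorem exists_bounded_commutator (hL : ∀ g, ∃ C, ∀ γ, |L (g + γ) - L γ| ≤ C)
    {x : TwistedGroupCStar σ} (hx : x ∈ finitelySupported σ) :
    ∃ B : LTwo G →L[ℂ] LTwo G, ∀ ξ η : LTwo G, (∀ γ, η γ = L γ * ξ γ) →
      ∀ γ, (L γ : ℂ) * regularRep σ x ξ γ = (B ξ + regularRep σ x η) γ := by
  rw [mem_finitelySupported] at hx
  -- The claim is phrased with `η` standing for `L ξ` instead of through operator domains, which
  -- makes it linear in `x` and reduces it to generators.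
  induction hx using Submodule.span_induction with
  | mem x hx =>
    obtain ⟨a, rfl⟩ := hx
    obtain ⟨C, hC⟩ := hL a
    -- On `δ_a` the commutator is the translation followed by multiplication by `L γ - L(-a + γ)`,
    -- bounded by the hypothesis at the point `-a + γ`.
    refine ⟨diagOperator (fun γ => ((L γ - L (-a + γ) : ℝ) : ℂ)) C (fun γ => ?_) ∘L
      regularRep σ (delta σ a), fun ξ η h γ => ?_⟩
    · rw [Complex.norm_real, Real.norm_eq_abs]
      simpa using hC (-a + γ)
    · have h1 (f : LTwo G) :
          regularRep σ (delta σ a) f γ = (σ a (-a + γ) : ℂ) * f (-a + γ) := rfl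
      rw [lp.coeFn_add, Pi.add_apply, ContinuousLinearMap.comp_apply, diagOperator_apply, h1, h1, h]
      push_cast
      ring
  | zero => exact ⟨0, fun ξ η _ γ => by simp⟩
  | add x y _ _ hx hy =>
    obtain ⟨B, hB⟩ := hx
    obtain ⟨B', hB'⟩ := hy
    refine ⟨B + B', fun ξ η h γ => ?_⟩
    have h1 := hB ξ η h γ
    have h2 := hB' ξ η h γ
    simp only [map_add, add_apply, lp.coeFn_add, Pi.add_apply] at h1 h2 ⊢
    rw [mul_add, h1, h2]
    ring
  | smul c x _ hx =>
    obtain ⟨B, hB⟩ := hx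
    refine ⟨c • B, fun ξ η h γ => ?_⟩
    have h1 := hB ξ η h γ
    simp only [map_smul, smul_apply, lp.coeFn_add, Pi.add_apply, lp.coeFn_smul, Pi.smul_apply,
      smul_eq_mul] at h1 ⊢
    rw [mul_left_comm, h1]
    ring

/-- The product `L · λ(x)ξ` equals `B ξ + λ(x)(L ξ)`, a sum of two `ℓ²` vectors. Hence the
commutator is defined on the whole domain of `mulOperator L`. -/
theorem regularRep_mem_mulOperator_domain (hL : ∀ g, ∃ C, ∀ γ, |L (g + γ) - L γ| ≤ C)
    {x : TwistedGroupCStar σ} (hx : x ∈ finitelySupported σ) {ξ : LTwo G}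
    (hξ : ξ ∈ (mulOperator L).domain) : regularRep σ x ξ ∈ (mulOperator L).domain := by
  obtain ⟨B, hB⟩ := exists_bounded_commutator σ L hL hx
  exact mem_mulOperator_domain_of_eq L fun γ =>
    (hB ξ (mulOperator L ⟨ξ, hξ⟩) (fun _ => rfl) γ).symm

end Commutator

/-- The regular representation of an abelian group together with multiplication by a proper length
function is a spectral triple, also after composition with an isomorphism onto `C*(G, σ)`. -/
theorem isSpectralTriple_of_mulOperator {G : Type u} [AddCommGroup G] (σ : Multiplier G)
    (L : G → ℝ) (hL : ∀ g, ∃ C, ∀ γ, |L (g + γ) - L γ| ≤ C)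
    (hproper : Filter.Tendsto L Filter.cofinite Filter.atTop)
    {A : Type*} [CStarAlgebra A] (υ : A →⋆ₐ[ℂ] TwistedGroupCStar σ) (hυ : Function.Injective υ)
    (S : StarSubalgebra ℂ A) (hS : Dense (S : Set A))
    (hυS : ∀ a ∈ S, υ a ∈ TwistedGroupCStar.finitelySupported σ) :
    TripleData.IsSpectralTriple
      { rep := (regularRep σ).comp υ, dirac := mulOperator L, smooth := S } where
  faithful := (regularRep_injective σ).comp hυ
  selfAdjoint := isSelfAdjoint_mulOperator L
  compactResolvent := hasCompactResolvent_mulOperator L hproper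
  dense_smooth := hS
  dense_commutator a ha :=
    (dense_mulOperator_domain L).mono fun _ hξ =>
      ⟨hξ, regularRep_mem_mulOperator_domain σ L hL (hυS a ha) hξ⟩
  bounded_commutator a ha := by
    obtain ⟨B, hB⟩ := exists_bounded_commutator σ L hL (hυS a ha)
    refine ⟨B, fun ξ => lp.ext (funext fun γ => ?_)⟩
    have h := hB ξ (mulOperator L ⟨ξ, ξ.2.1⟩) (fun _ => rfl) γ
    rw [lp.coeFn_add, Pi.add_apply] at h
    exact sub_eq_of_eq_add h

/-! ### Commutators under morphisms of triples -/

section Morphisms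

variable {A₁ A₂ H₁ H₂ : Type*} [CStarAlgebra A₁] [CStarAlgebra A₂]
variable [NormedAddCommGroup H₁] [InnerProductSpace ℂ H₁] [CompleteSpace H₁]
variable [NormedAddCommGroup H₂] [InnerProductSpace ℂ H₂] [CompleteSpace H₂]

/-- A morphism intertwines both the operator and the representation, hence their commutator. With an
isometric `I`, bounds pull back from the target to the source. -/
theorem IsMorphism.map_commutator {T₁ : TripleData A₁ H₁} {T₂ : TripleData A₂ H₂}
    {φ : A₁ →⋆ₐ[ℂ] A₂} {I : H₁ →L[ℂ] H₂} (h : IsMorphism T₁ T₂ φ I) (a : A₁)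
    (ξ : (commutator T₁.dirac (T₁.rep a)).domain) :
    ∃ hξ : I ξ ∈ (commutator T₂.dirac (T₂.rep (φ a))).domain,
      I (commutator T₁.dirac (T₁.rep a) ξ) = commutator T₂.dirac (T₂.rep (φ a)) ⟨I ξ, hξ⟩ := by
  have hI (x : H₁) : I (T₁.rep a x) = T₂.rep (φ a) (I x) := DFunLike.congr_fun (h.intertwine a) x
  have h1 : T₂.rep (φ a) (I ξ) ∈ T₂.dirac.domain := by
    rw [← hI]
    exact h.map_domain _ ξ.2.2
  refine ⟨⟨h.map_domain _ ξ.2.1, h1⟩, ?_⟩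
  change I (T₁.dirac ⟨T₁.rep a ξ, ξ.2.2⟩ - T₁.rep a (T₁.dirac ⟨ξ, ξ.2.1⟩))
    = T₂.dirac ⟨T₂.rep (φ a) (I ξ), h1⟩ - T₂.rep (φ a) (T₂.dirac ⟨I ξ, h.map_domain _ ξ.2.1⟩)
  have e1 : I (T₁.dirac ⟨T₁.rep a ξ, ξ.2.2⟩) = T₂.dirac ⟨T₂.rep (φ a) (I ξ), h1⟩ :=
    (h.map_dirac _).trans (congrArg T₂.dirac (Subtype.ext (hI ξ)))
  have e2 : I (T₁.rep a (T₁.dirac ⟨ξ, ξ.2.1⟩))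
      = T₂.rep (φ a) (T₂.dirac ⟨I ξ, h.map_domain _ ξ.2.1⟩) :=
    (hI _).trans (congrArg (T₂.rep (φ a)) (h.map_dirac ⟨ξ, ξ.2.1⟩))
  exact (map_sub I _ _).trans (congrArg₂ _ e1 e2)

end Morphisms

/-! ### Extension by zero and its adjoint -/

section Extension

variable {X Y Z : Type u}

theorem extendIsometry_comp (e : X → Y) (he : Function.Injective e) (e' : Y → Z)
    (he' : Function.Injective e') (d : X → Z) (hd : Function.Injective d)
    (h : ∀ x, e' (e x) = d x) (f : LTwo X) :
    extendIsometry e' he' (extendIsometry e he f) = extendIsometry d hd f := by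
  refine lp.ext (funext fun z => ?_)
  by_cases hz : z ∈ Set.range d
  · obtain ⟨x, rfl⟩ := hz
    rw [extendIsometry_apply, ← h, extendIsometry_apply, extendIsometry_apply]
  · rw [extendIsometry_apply_of_notMem d hd f hz]
    by_cases hz' : z ∈ Set.range e'
    · obtain ⟨y, rfl⟩ := hz'
      rw [extendIsometry_apply, extendIsometry_apply_of_notMem]
      rintro ⟨x, rfl⟩
      exact hz ⟨x, (h x).symm⟩
    · exact extendIsometry_apply_of_notMem _ _ _ hz'

theorem extendIsometry_mulOperator (e : X → Y) (he : Function.Injective e) (L : Y → ℝ)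
    (f : (mulOperator fun x => L (e x)).domain) (y : Y) :
    extendIsometry e he (mulOperator (fun x => L (e x)) f) y
      = (L y : ℂ) * extendIsometry e he f y := by
  by_cases hy : y ∈ Set.range e
  · obtain ⟨x, rfl⟩ := hy
    rw [extendIsometry_apply, extendIsometry_apply, mulOperator_apply]
  · rw [extendIsometry_apply_of_notMem _ _ _ hy, extendIsometry_apply_of_notMem _ _ _ hy, mul_zero]

theorem extendIsometry_mem_domain (e : X → Y) (he : Function.Injective e) (L : Y → ℝ) {f : LTwo X}
    (hf : f ∈ (mulOperator fun x => L (e x)).domain) :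
    extendIsometry e he f ∈ (mulOperator L).domain :=
  mem_mulOperator_domain_of_eq L (extendIsometry_mulOperator e he L ⟨f, hf⟩)

/-- Extension by zero carries basis vectors to basis vectors, so pairing with them identifies its
adjoint as restriction along `e`. -/
theorem adjoint_extendIsometry_apply (e : X → Y) (he : Function.Injective e) (f : LTwo Y) (x : X) :
    (extendIsometry e he).toContinuousLinearMap.adjoint f x = f (e x) := by
  classical
  have hs : extendIsometry e he (lp.single 2 x 1) = lp.single 2 (e x) 1 := by
    refine lp.ext (funext fun y => ?_)
    by_cases hy : y ∈ Set.range e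
    · obtain ⟨x', rfl⟩ := hy
      rw [extendIsometry_apply, lp.single_apply, lp.single_apply]
      by_cases h : x' = x
      · subst h; simp
      · simp [h, he.ne h]
    · rw [extendIsometry_apply_of_notMem _ _ _ hy, lp.single_apply_ne]
      rintro rfl
      exact hy ⟨x, rfl⟩
  have h := ContinuousLinearMap.adjoint_inner_right
    (extendIsometry e he).toContinuousLinearMap (lp.single 2 x 1) f
  rw [LinearIsometry.coe_toContinuousLinearMap, hs, lp.inner_single_left,
    lp.inner_single_left] at h
  simpa using h

theorem extendIsometry_adjoint_of_support (e : X → Y) (he : Function.Injective e) {f : LTwo Y}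
    (hf : ∀ y ∉ Set.range e, f y = 0) :
    extendIsometry e he ((extendIsometry e he).toContinuousLinearMap.adjoint f) = f := by
  refine lp.ext (funext fun y => ?_)
  by_cases hy : y ∈ Set.range e
  · obtain ⟨x, rfl⟩ := hy
    rw [extendIsometry_apply, adjoint_extendIsometry_apply]
  · rw [extendIsometry_apply_of_notMem _ _ _ hy, hf y hy]

end Extension

/-! ### Triangle inequality and properness of the length function -/

section Length

variable (p : ℕ) [hp : Fact p.Prime]

theorem baseLength_nonneg (r : zInv p) : 0 ≤ baseLength p r :=
  add_nonneg (abs_nonneg _) (by exact_mod_cast padicNorm.nonneg _)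

/-- Both absolute values obey the triangle inequality; the lower bound comes from writing `s = (r +
s) + (-r)`. -/
theorem abs_baseLength_add_sub_le (r s : zInv p) :
    |baseLength p (r + s) - baseLength p s| ≤ baseLength p r := by
  have h1 : (padicNorm p ((r + s : zInv p) : ℚ) : ℝ) ≤ padicNorm p r + padicNorm p s := by
    exact_mod_cast padicNorm.triangle_ineq (r : ℚ) s
  have h2 : (padicNorm p (s : ℚ) : ℝ) ≤ padicNorm p ((r + s : zInv p) : ℚ) + padicNorm p r := by
    have := padicNorm.triangle_ineq (p := p) ((r + s : zInv p) : ℚ) (-r)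
    rw [padicNorm.neg] at this
    have h : ((r + s : zInv p) : ℚ) + -r = s := by push_cast; ring
    rw [h] at this
    exact_mod_cast this
  have h3 : |(((r + s : zInv p) : ℚ) : ℝ)| ≤ |((r : ℚ) : ℝ)| + |((s : ℚ) : ℝ)| := by
    push_cast
    exact abs_add_le _ _
  have h4 : |((s : ℚ) : ℝ)| ≤ |(((r + s : zInv p) : ℚ) : ℝ)| + |((r : ℚ) : ℝ)| := by
    have := abs_sub (((r + s : zInv p) : ℚ) : ℝ) ((r : ℚ) : ℝ)
    push_cast at this ⊢
    rwa [add_sub_cancel_left] at this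
  unfold baseLength
  rw [abs_le]
  constructor <;> linarith

theorem abs_solenoidLength_add_sub_le (g γ : solenoidGroup p) :
    |solenoidLength p (g + γ) - solenoidLength p γ| ≤ solenoidLength p g := by
  have h1 := abs_le.1 (abs_baseLength_add_sub_le p g.1 γ.1)
  have h2 := abs_le.1 (abs_baseLength_add_sub_le p g.2 γ.2)
  unfold solenoidLength
  rw [Prod.fst_add, Prod.snd_add, abs_le]
  constructor <;> linarith [h1.1, h1.2, h2.1, h2.2]

/-- Denominators in `ℤ[1/p]` are powers of `p`, and the `p`-adic norm measures exactly that power.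
-/
theorem exists_eq_div_of_padicNorm_le {r : ℚ} (hr : r ∈ zInv p) {n : ℕ}
    (h : padicNorm p r ≤ (p : ℚ) ^ n) : ∃ b : ℤ, r = b / (p : ℚ) ^ n := by
  have hp0 : (p : ℚ) ≠ 0 := Nat.cast_ne_zero.2 hp.out.ne_zero
  have hppos : (0 : ℚ) < p := Nat.cast_pos.2 hp.out.pos
  obtain ⟨a, k, rfl⟩ := hr
  rcases le_total k n with hkn | hkn
  · obtain ⟨d, rfl⟩ := Nat.exists_eq_add_of_le hkn
    exact ⟨a * p ^ d, by push_cast; field_simp; ring⟩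
  · obtain ⟨d, rfl⟩ := Nat.exists_eq_add_of_le hkn
    -- With denominator `p ^ (n + d)`, the hypothesis says that `p ^ d` divides `a`, so the excess
    -- power cancels.
    have h1 : padicNorm p a ≤ (p : ℚ) ^ (-d : ℤ) := by
      have h2 : padicNorm p ((p : ℚ) ^ (n + d)) = ((p : ℚ) ^ (n + d))⁻¹ := by
        induction n + d with
        | zero => simp
        | succ m ih =>
          rw [pow_succ, padicNorm.mul, ih, padicNorm.padicNorm_p_of_prime, mul_inv]
      rw [padicNorm.div, h2, div_inv_eq_mul, pow_add, mul_left_comm] at h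
      rw [zpow_neg, zpow_natCast, ← one_div, le_div_iff₀ (pow_pos hppos d)]
      exact le_of_mul_le_mul_left (by rwa [mul_one]) (pow_pos hppos n)
    obtain ⟨b, hb⟩ := (padicNorm.dvd_iff_norm_le (p := p) (n := d) (z := a)).2 h1
    refine ⟨b, ?_⟩
    rw [hb]; push_cast; field_simp; ring

/-- Choosing `C < p ^ n`, the `p`-adic term allows the denominator `p ^ n`, and the archimedean term
then confines the numerator to an interval of radius `C * p ^ n`. Neither term alone would give
finiteness. -/
theorem finite_baseLength_lt (C : ℝ) : {r : zInv p | baseLength p r < C}.Finite := by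
  have hp1 : (1 : ℝ) < p := by exact_mod_cast hp.out.one_lt
  obtain ⟨n, hn⟩ := pow_unbounded_of_one_lt C hp1
  obtain ⟨N, hN⟩ := exists_nat_gt (C * p ^ n)
  have hfin : ((fun b : ℤ => (b : ℚ) / (p : ℚ) ^ n) '' Set.Icc (-N : ℤ) N).Finite :=
    (Set.finite_Icc _ _).image _
  refine (hfin.preimage Subtype.val_injective.injOn).subset fun r hr => ?_
  have hr' : |((r : ℚ) : ℝ)| + (padicNorm p r : ℝ) < C := hr
  have h1 : (padicNorm p (r : ℚ) : ℝ) ≤ (p : ℝ) ^ n := by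
    linarith [abs_nonneg ((r : ℚ) : ℝ)]
  obtain ⟨b, hb⟩ := exists_eq_div_of_padicNorm_le p r.2 (n := n) (by exact_mod_cast h1)
  refine ⟨b, ?_, hb.symm⟩
  have h0 : (0 : ℝ) ≤ padicNorm p (r : ℚ) := by exact_mod_cast padicNorm.nonneg _
  have h2 : |((r : ℚ) : ℝ)| < C := by linarith
  have hpos : (0 : ℝ) < (p : ℝ) ^ n := by positivity
  rw [hb] at h2
  push_cast at h2
  rw [abs_div, abs_of_pos hpos, div_lt_iff₀ hpos] at h2
  have h3 : |(b : ℝ)| ≤ N := (h2.trans hN).le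
  rw [Set.mem_Icc, ← abs_le]
  exact_mod_cast h3

theorem tendsto_solenoidLength :
    Filter.Tendsto (solenoidLength p) Filter.cofinite Filter.atTop := by
  refine Filter.tendsto_atTop.2 fun C => Filter.eventually_cofinite.2 ?_
  refine ((finite_baseLength_lt p C).prod (finite_baseLength_lt p C)).subset fun γ hγ => ?_
  have h : baseLength p γ.1 + baseLength p γ.2 < C := not_le.1 hγ
  have h1 := baseLength_nonneg p γ.1
  have h2 := baseLength_nonneg p γ.2
  exact ⟨show baseLength p γ.1 < C by linarith, show baseLength p γ.2 < C by linarith⟩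

theorem exists_mem_subgroupAt (γ : solenoidGroup p) : ∃ j, γ ∈ subgroupAt p j := by
  have hp0 : (p : ℚ) ≠ 0 := Nat.cast_ne_zero.2 hp.out.ne_zero
  obtain ⟨a, k, ha⟩ := γ.1.2
  obtain ⟨b, l, hb⟩ := γ.2.2
  refine ⟨k + l, a * p ^ l, b * p ^ k, ?_, ?_⟩
  · rw [ha]; push_cast; field_simp; ring
  · rw [hb]; push_cast; field_simp; ring

theorem eventually_mem_subgroupAt (γ : solenoidGroup p) :
    ∀ᶠ j in Filter.atTop, γ ∈ subgroupAt p j := by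
  obtain ⟨j, hj⟩ := exists_mem_subgroupAt p γ
  filter_upwards [Filter.eventually_ge_atTop j] with k hk using subgroupAt_mono p hk hj

end Length

/-- The inverse is by construction again an induced map, along `e.symm` with inverted phases. -/
theorem mapEquiv_symm_mem_finitelySupported {G K : Type u} [AddGroup G] [AddGroup K]
    {σ : Multiplier G} {τ : Multiplier K} (e : G ≃+ K) (b : G → Circle)
    (hb : ∀ x y, σ x y * b (x + y) = b x * b y * τ (e x) (e y)) {x : TwistedGroupCStar τ}
    (hx : x ∈ TwistedGroupCStar.finitelySupported τ) :
    (TwistedGroupCStar.mapEquiv e b hb).symm x ∈ TwistedGroupCStar.finitelySupported σ :=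
  map_mem_finitelySupported e.symm.toAddMonoidHom (fun y => (b (e.symm y))⁻¹)
    (by simpa using TwistedGroupCStar.map_symm_compat e b hb) hx

/-! ### Inclusions of the spaces `ℓ²(Γ_j)` -/

section Inclusions

variable {p : ℕ} [hp : Fact p.Prime]

theorem inclusionMapLim_apply (j : ℕ) (f : LTwo (subgroupAt p j)) (γ : subgroupAt p j) :
    inclusionMapLim p j f γ = f γ :=
  extendIsometry_apply (subgroupAt p j).subtype Subtype.val_injective f γ

theorem inclusionMapLim_apply_of_notMem (j : ℕ) (f : LTwo (subgroupAt p j)) {γ : solenoidGroup p}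
    (hγ : γ ∉ subgroupAt p j) : inclusionMapLim p j f γ = 0 :=
  extendIsometry_apply_of_notMem (subgroupAt p j).subtype Subtype.val_injective f (by
    rintro ⟨x, rfl⟩
    exact hγ x.2)

theorem adjoint_inclusionMapLim_apply (j : ℕ) (f : LTwo (solenoidGroup p)) (γ : subgroupAt p j) :
    (inclusionMapLim p j).adjoint f γ = f γ :=
  adjoint_extendIsometry_apply (subgroupAt p j).subtype Subtype.val_injective f γ

theorem norm_inclusionMapLim (j : ℕ) (f : LTwo (subgroupAt p j)) : ‖inclusionMapLim p j f‖ = ‖f‖ :=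
  (extendIsometry (subgroupAt p j).subtype Subtype.val_injective).norm_map f

theorem isometry_inclusionMapLim (j : ℕ) : Isometry (inclusionMapLim p j) :=
  (extendIsometry (subgroupAt p j).subtype Subtype.val_injective).isometry

theorem inclusionMap_comp (j k l : ℕ) (hjk : j ≤ k) (hkl : k ≤ l) :
    inclusionMap p k l hkl ∘L inclusionMap p j k hjk = inclusionMap p j l (hjk.trans hkl) :=
  ContinuousLinearMap.ext <| extendIsometry_comp
    (AddSubgroup.inclusion (subgroupAt_mono p hjk)) (AddSubgroup.inclusion_injective _)
    (AddSubgroup.inclusion (subgroupAt_mono p hkl)) (AddSubgroup.inclusion_injective _)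
    (AddSubgroup.inclusion (subgroupAt_mono p (hjk.trans hkl))) (AddSubgroup.inclusion_injective _)
    fun _ => rfl

theorem inclusionMapLim_comp (j k : ℕ) (h : j ≤ k) :
    inclusionMapLim p k ∘L inclusionMap p j k h = inclusionMapLim p j :=
  ContinuousLinearMap.ext <| extendIsometry_comp
    (AddSubgroup.inclusion (subgroupAt_mono p h)) (AddSubgroup.inclusion_injective _)
    (subgroupAt p k).subtype Subtype.val_injective
    (subgroupAt p j).subtype Subtype.val_injective fun _ => rfl

end Inclusions

/-! ### The inductive system of rotation algebras -/

section System

open TwistedGroupCStar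

variable {p : ℕ} [hp : Fact p.Prime] (θ : Omega p)

theorem upsilon_mem_finitelySupported (j : ℕ) {a : RotationAlgebra θ j}
    (ha : a ∈ finitelySupported _) : upsilon θ j a ∈ finitelySupported _ :=
  map_mem_finitelySupported (latticeEquiv p j).toAddMonoidHom _ (upsilon_compat θ j) ha

theorem upsilon_symm_mem_finitelySupported (j : ℕ)
    {a : TwistedGroupCStar (restrictedMultiplier θ j)}
    (ha : a ∈ finitelySupported _) : (upsilon θ j).symm a ∈ finitelySupported _ :=
  mapEquiv_symm_mem_finitelySupported (latticeEquiv p j) _ (upsilon_compat θ j) ha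

/-- Transporting by `upsilon` turns `phi` into `beta`, whose composition laws can be checked on
generators. -/
theorem upsilon_phi (j k : ℕ) (h : j ≤ k) (a : RotationAlgebra θ j) :
    upsilon θ k (phi θ j k h a) = beta θ j k h (upsilon θ j a) :=
  (upsilon θ k).apply_symm_apply _

theorem beta_comp (j k l : ℕ) (hjk : j ≤ k) (hkl : k ≤ l) :
    (beta θ k l hkl).comp (beta θ j k hjk) = beta θ j l (hjk.trans hkl) :=
  hom_ext fun a => by
    simp only [StarAlgHom.comp_apply, beta, map_delta, Circle.coe_one, one_smul]
    rfl

theorem betaLim_comp (j k : ℕ) (h : j ≤ k) :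
    (betaLim θ k).comp (beta θ j k h) = betaLim θ j :=
  hom_ext fun a => by
    simp only [StarAlgHom.comp_apply, beta, betaLim, map_delta, Circle.coe_one, one_smul]
    rfl

theorem phi_comp (j k l : ℕ) (hjk : j ≤ k) (hkl : k ≤ l) :
    (phi θ k l hkl).comp (phi θ j k hjk) = phi θ j l (hjk.trans hkl) := by
  ext a
  refine EquivLike.injective (upsilon θ l) ?_
  rw [StarAlgHom.comp_apply, upsilon_phi, upsilon_phi, upsilon_phi, ← beta_comp θ j k l hjk hkl]
  rfl

theorem phiLim_comp_phi (j k : ℕ) (h : j ≤ k) : (phiLim θ k).comp (phi θ j k h) = phiLim θ j := by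
  ext a
  change betaLim θ k (upsilon θ k (phi θ j k h a)) = betaLim θ j (upsilon θ j a)
  rw [upsilon_phi, ← betaLim_comp θ j k h]
  rfl

theorem phi_mem_finitelySupported (j k : ℕ) (h : j ≤ k) {a : RotationAlgebra θ j}
    (ha : a ∈ finitelySupported _) : phi θ j k h a ∈ finitelySupported _ :=
  upsilon_symm_mem_finitelySupported θ k
    (map_mem_finitelySupported _ _ _ (upsilon_mem_finitelySupported θ j ha))

theorem phiLim_mem_finitelySupported (j : ℕ) {a : RotationAlgebra θ j}
    (ha : a ∈ finitelySupported _) : phiLim θ j a ∈ finitelySupported _ :=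
  map_mem_finitelySupported _ _ _ (upsilon_mem_finitelySupported θ j ha)

theorem phi_injective (j k : ℕ) (h : j ≤ k) : Function.Injective (phi θ j k h) :=
  (upsilon θ k).symm.injective.comp
    ((map_injective _ (AddSubgroup.inclusion_injective _) _).comp (upsilon θ j).injective)

theorem phiLim_injective (j : ℕ) : Function.Injective (phiLim θ j) :=
  (map_injective (subgroupAt p j).subtype Subtype.val_injective _).comp (upsilon θ j).injective

theorem exists_bound_solenoidLength_sub (g : solenoidGroup p) :
    ∃ C, ∀ γ, |solenoidLength p (g + γ) - solenoidLength p γ| ≤ C :=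
  ⟨_, abs_solenoidLength_add_sub_le p g⟩

theorem isSpectralTriple_rotationTriple (j : ℕ) : (rotationTriple θ j).IsSpectralTriple :=
  isSpectralTriple_of_mulOperator (restrictedMultiplier θ j)
    (fun γ : subgroupAt p j => solenoidLength p γ)
    (fun g => (exists_bound_solenoidLength_sub (g : solenoidGroup p)).imp fun _ h γ => h γ)
    ((tendsto_solenoidLength p).comp Subtype.val_injective.tendsto_cofinite)
    (upsilon θ j : RotationAlgebra θ j →⋆ₐ[ℂ] _) (EquivLike.injective (upsilon θ j))
    (finitelySupported (rotationMultiplier (θ.1 (2 * j)))) (dense_finitelySupported _)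
    fun _ => upsilon_mem_finitelySupported θ j

theorem isSpectralTriple_solenoidTriple : (solenoidTriple θ).IsSpectralTriple :=
  isSpectralTriple_of_mulOperator (solenoidMultiplier θ) (solenoidLength p)
    exists_bound_solenoidLength_sub (tendsto_solenoidLength p)
    (StarAlgHom.id ℂ (SolenoidAlgebra θ)) Function.injective_id
    (finitelySupported (solenoidMultiplier θ))
    (dense_finitelySupported _) fun _ h => h

theorem isIsometricMorphism_phi (j k : ℕ) (h : j ≤ k) :
    IsIsometricMorphism (rotationTriple θ j) (rotationTriple θ k) (phi θ j k h)
      (inclusionMap p j k h) where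
  map_smooth _ := phi_mem_finitelySupported θ j k h
  intertwine a := by
    have hb (x y : subgroupAt p j) : restrictedMultiplier θ j x y * (1 : Circle)
        = 1 * 1 * restrictedMultiplier θ k (AddSubgroup.inclusion (subgroupAt_mono p h) x)
          (AddSubgroup.inclusion (subgroupAt_mono p h) y) := by
      rw [mul_one, mul_one, one_mul]; rfl
    have h1 := extendIsometry_regularRep (AddSubgroup.inclusion (subgroupAt_mono p h))
      (AddSubgroup.inclusion_injective _) hb (upsilon θ j a)
    have h2 : regularRep (restrictedMultiplier θ k) (upsilon θ k (phi θ j k h a))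
        = regularRep (restrictedMultiplier θ k) (beta θ j k h (upsilon θ j a)) :=
      congrArg _ (upsilon_phi θ j k h a)
    exact h1.trans (congrArg (· ∘L inclusionMap p j k h) h2.symm)
  map_domain _ hξ := extendIsometry_mem_domain (AddSubgroup.inclusion (subgroupAt_mono p h))
    (AddSubgroup.inclusion_injective _) (fun γ : subgroupAt p k => solenoidLength p γ) hξ
  map_dirac ξ := lp.ext (funext (extendIsometry_mulOperator
    (AddSubgroup.inclusion (subgroupAt_mono p h)) (AddSubgroup.inclusion_injective _)
    (fun γ : subgroupAt p k => solenoidLength p γ) ξ))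
  injective := phi_injective θ j k h
  isometry := (extendIsometry (AddSubgroup.inclusion (subgroupAt_mono p h))
    (AddSubgroup.inclusion_injective _)).isometry

theorem isIsometricMorphism_phiLim (j : ℕ) :
    IsIsometricMorphism (rotationTriple θ j) (solenoidTriple θ) (phiLim θ j)
      (inclusionMapLim p j) where
  map_smooth _ := phiLim_mem_finitelySupported θ j
  intertwine a := extendIsometry_regularRep (subgroupAt p j).subtype Subtype.val_injective
    (fun x y => by rw [mul_one, mul_one, one_mul]; rfl) (upsilon θ j a)
  map_domain _ hξ := extendIsometry_mem_domain (subgroupAt p j).subtype Subtype.val_injective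
    (solenoidLength p) hξ
  map_dirac ξ := lp.ext (funext (extendIsometry_mulOperator (subgroupAt p j).subtype
    Subtype.val_injective (solenoidLength p) ξ))
  injective := phiLim_injective θ j
  isometry := isometry_inclusionMapLim j

theorem isInductiveSystem_rotationTriple :
    IsInductiveSystem (rotationTriple θ) (phi θ) (inclusionMap p) where
  isSpectralTriple := isSpectralTriple_rotationTriple θ
  isIsometricMorphism := isIsometricMorphism_phi θ
  comp_alg := phi_comp θ
  comp_hilbert := inclusionMap_comp

/-- For `k ≥ j` the image of `a` in the solenoid algebra is always `phiLim θ j a`. Each commutator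
is therefore the restriction to `ℓ²(Γ_k)` of a single bounded commutator on `ℓ²(Γ)`, and `‖B‖`
serves for all `k`. -/
theorem commutatorsUniformlyBounded_rotationTriple :
    CommutatorsUniformlyBounded (rotationTriple θ) (phi θ) := by
  intro j a ha
  obtain ⟨B, hB⟩ := (isSpectralTriple_solenoidTriple θ).bounded_commutator _
    (phiLim_mem_finitelySupported θ j ha)
  refine ⟨‖B‖, fun k h ξ => ?_⟩
  obtain ⟨hξ, e⟩ := (isIsometricMorphism_phiLim θ k).toIsMorphism.map_commutator _ ξ
  have hk : phiLim θ k (phi θ j k h a) = phiLim θ j a :=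
    DFunLike.congr_fun (phiLim_comp_phi θ j k h) a
  rw [← norm_inclusionMapLim, ← norm_inclusionMapLim k (ξ : LTwo (subgroupAt p k)), e]
  clear e
  -- The membership proof `hξ` depends on the algebra element; abstracting the vector and reverting
  -- `hξ` lets `hk` rewrite both together.
  generalize inclusionMapLim p k (ξ : LTwo (subgroupAt p k)) = η at hξ ⊢
  revert hξ
  rw [hk]
  intro hξ
  exact (congrArg norm (hB ⟨η, hξ⟩)).trans_le (B.le_opNorm η)

/-! ### Identification of the limits and resolvent convergence -/

theorem delta_mem_range_phiLim (j : ℕ) {γ : solenoidGroup p} (hγ : γ ∈ subgroupAt p j) :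
    ∃ a ∈ finitelySupported (rotationMultiplier (θ.1 (2 * j))),
      phiLim θ j a = delta (solenoidMultiplier θ) γ := by
  refine ⟨(upsilon θ j).symm (delta _ ⟨γ, hγ⟩),
    upsilon_symm_mem_finitelySupported θ j (delta_mem_finitelySupported _ _), ?_⟩
  change betaLim θ j (upsilon θ j ((upsilon θ j).symm _)) = _
  rw [StarAlgEquiv.apply_symm_apply, betaLim, map_delta, Circle.coe_one, one_smul]
  rfl

/-- A finite subset of `Γ` lies in a single `Γ_j`; in the induction two summands are moved to the
common stage `max j k`. -/
theorem finitelySupported_eq_iUnion :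
    (finitelySupported (solenoidMultiplier θ) : Set (SolenoidAlgebra θ))
      = ⋃ j, phiLim θ j '' (finitelySupported (rotationMultiplier (θ.1 (2 * j))) : Set _) := by
  refine Set.Subset.antisymm (fun x hx => ?_) (Set.iUnion_subset fun j => ?_)
  · rw [SetLike.mem_coe, mem_finitelySupported] at hx
    induction hx using Submodule.span_induction with
    | mem x hx =>
      obtain ⟨γ, rfl⟩ := hx
      obtain ⟨j, hj⟩ := exists_mem_subgroupAt p γ
      exact Set.mem_iUnion.2 ⟨j, delta_mem_range_phiLim θ j hj⟩
    | zero => exact Set.mem_iUnion.2 ⟨0, 0, zero_mem _, map_zero _⟩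
    | add x y _ _ hx hy =>
      obtain ⟨j, a, ha, rfl⟩ := Set.mem_iUnion.1 hx
      obtain ⟨k, b, hb, rfl⟩ := Set.mem_iUnion.1 hy
      refine Set.mem_iUnion.2 ⟨max j k, phi θ j _ (le_max_left _ _) a
        + phi θ k _ (le_max_right _ _) b,
        add_mem (phi_mem_finitelySupported θ _ _ _ ha) (phi_mem_finitelySupported θ _ _ _ hb), ?_⟩
      rw [map_add, ← phiLim_comp_phi θ j _ (le_max_left j k),
        ← phiLim_comp_phi θ k _ (le_max_right j k)]
      rfl
    | smul c x _ hx =>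
      obtain ⟨j, a, ha, rfl⟩ := Set.mem_iUnion.1 hx
      exact Set.mem_iUnion.2 ⟨j, c • a, SMulMemClass.smul_mem c ha, map_smul _ _ _⟩
  · rintro _ ⟨a, ha, rfl⟩
    exact phiLim_mem_finitelySupported θ j ha

variable (p) in
/-- The elements of `ℓ²(Γ)` supported in one of the subgroups `Γ_j`. -/
def supportedInSubgroup : Submodule ℂ (LTwo (solenoidGroup p)) where
  carrier := {f | ∃ j, ∀ γ ∉ subgroupAt p j, f γ = 0}
  add_mem' := by
    rintro f g ⟨j, hf⟩ ⟨k, hg⟩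
    refine ⟨max j k, fun γ hγ => ?_⟩
    rw [lp.coeFn_add, Pi.add_apply,
      hf γ fun h => hγ (subgroupAt_mono p (le_max_left j k) h),
      hg γ fun h => hγ (subgroupAt_mono p (le_max_right j k) h), add_zero]
  zero_mem' := ⟨0, fun _ _ => rfl⟩
  smul_mem' := by
    rintro c f ⟨j, hf⟩
    refine ⟨j, fun γ hγ => ?_⟩
    rw [lp.coeFn_smul, Pi.smul_apply, hf γ hγ, smul_zero]

theorem single_mem_supportedInSubgroup [DecidableEq (solenoidGroup p)] (γ : solenoidGroup p)
    (c : ℂ) : lp.single 2 γ c ∈ supportedInSubgroup p := by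
  obtain ⟨j, hj⟩ := exists_mem_subgroupAt p γ
  refine ⟨j, fun η hη => lp.single_apply_ne _ _ _ ?_⟩
  rintro rfl
  exact hη hj

theorem inclusionMapLim_mem_supportedInSubgroup (j : ℕ) (f : LTwo (subgroupAt p j)) :
    inclusionMapLim p j f ∈ supportedInSubgroup p :=
  ⟨j, fun _ hγ => inclusionMapLim_apply_of_notMem j f hγ⟩

theorem inclusionMapLim_adjoint {j : ℕ} {f : LTwo (solenoidGroup p)}
    (hf : ∀ γ ∉ subgroupAt p j, f γ = 0) :
    inclusionMapLim p j ((inclusionMapLim p j).adjoint f) = f :=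
  extendIsometry_adjoint_of_support _ _ fun γ hγ => hf γ fun h => hγ ⟨⟨γ, h⟩, rfl⟩

theorem isHilbertLimit_inclusionMapLim : IsHilbertLimit (inclusionMap p) (inclusionMapLim p) where
  compat := inclusionMapLim_comp
  isometry := isometry_inclusionMapLim
  dense := by
    classical
    refine (dense_of_single_mem (supportedInSubgroup p) single_mem_supportedInSubgroup).mono ?_
    rintro f ⟨j, hf⟩
    exact Set.mem_iUnion.2 ⟨j, _, inclusionMapLim_adjoint hf⟩

theorem isCStarLimit_phiLim : IsCStarLimit (phi θ) (phiLim θ) where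
  compat := phiLim_comp_phi θ
  injective := phiLim_injective θ
  dense := by
    refine (dense_finitelySupported (solenoidMultiplier θ)).mono ?_
    rw [finitelySupported_eq_iUnion]
    exact Set.iUnion_mono fun j => Set.image_subset_range _ _

/-- A restriction of a multiplication operator to a domain containing the finitely supported
functions has the multiplication operator as its closure. -/
theorem closure_eq_mulOperator {X : Type u} [DecidableEq X] (L : X → ℝ)
    {D₀ : LTwo X →ₗ.[ℂ] LTwo X} (hle : D₀ ≤ mulOperator L)
    (hs : ∀ x c, lp.single 2 x c ∈ D₀.domain) : D₀.IsClosable ∧ mulOperator L = D₀.closure := by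
  have hclosed : (mulOperator L).IsClosed := (isSelfAdjoint_mulOperator L).isClosed
  have hcl : D₀.IsClosable := hclosed.isClosable.leIsClosable hle
  refine ⟨hcl, LinearPMap.eq_of_eq_graph ?_⟩
  rw [← hcl.graph_closure_eq_closure_graph]
  refine le_antisymm (fun z hz => ?_)
    (D₀.graph.topologicalClosure_minimal (LinearPMap.le_graph_of_le hle) hclosed)
  obtain ⟨f, hf1, hf2⟩ := (LinearPMap.mem_graph_iff _).1 hz
  have h1 := lp.hasSum_single ENNReal.ofNat_ne_top (f : LTwo X)
  have h2 := lp.hasSum_single ENNReal.ofNat_ne_top (mulOperator L f)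
  have h3 := h1.prodMk h2
  have hz' : z = ((f : LTwo X), mulOperator L f) := Prod.ext hf1.symm hf2.symm
  rw [hz']
  -- Finite truncations of `f` converge together with their images under multiplication by `L`, so
  -- each point of the large graph is a limit of points of the graph of `D₀`.
  refine mem_closure_of_tendsto h3 (.of_forall fun s => D₀.graph.sum_mem fun x _ => ?_)
  refine (LinearPMap.mem_graph_iff _).2 ⟨⟨_, hs x (f.1 x)⟩, rfl, ?_⟩
  refine (hle.2 (y := ⟨_, single_mem_mulOperator_domain L x (f.1 x)⟩) rfl).trans ?_
  rw [mulOperator_single, mulOperator_apply, ← smul_eq_mul, lp.single_smul]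

theorem isInductiveRealization_solenoidTriple :
    IsInductiveRealization (rotationTriple θ) (phi θ) (inclusionMap p) (solenoidTriple θ)
      (phiLim θ) (inclusionMapLim p) where
  algebra := isCStarLimit_phiLim θ
  hilbert := isHilbertLimit_inclusionMapLim
  rep j a := ((isIsometricMorphism_phiLim θ j).intertwine a).symm
  smooth := finitelySupported_eq_iUnion θ
  dirac := by
    classical
    -- The algebraic limit operator is the multiplication operator cut down to domain vectors
    -- supported in some `Γ_j`.
    let D₀ := (mulOperator (solenoidLength p)).domRestrict (supportedInSubgroup p)
    have hle : D₀ ≤ mulOperator (solenoidLength p) := LinearPMap.domRestrict_le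
    refine ⟨D₀, ⟨?_, fun j ξ η h => ?_⟩, closure_eq_mulOperator _ hle fun γ c =>
      ⟨single_mem_supportedInSubgroup γ c, single_mem_mulOperator_domain _ γ c⟩⟩
    · refine Set.Subset.antisymm ?_ (Set.iUnion_subset fun j => ?_)
      · rintro f ⟨⟨j, hf⟩, hfd⟩
        refine Set.mem_iUnion.2 ⟨j, _, ?_, inclusionMapLim_adjoint hf⟩
        -- The witness is the restriction to `Γ_j` of `L f`, since the adjoint of the inclusion is
        -- restriction.
        refine mem_mulOperator_domain_of_eq _
          (g := (inclusionMapLim p j).adjoint (mulOperator (solenoidLength p) ⟨f, hfd⟩))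
          fun γ => ?_
        rw [adjoint_inclusionMapLim_apply, adjoint_inclusionMapLim_apply]
        rfl
      · rintro _ ⟨f, hf, rfl⟩
        exact ⟨inclusionMapLim_mem_supportedInSubgroup j f,
          (isIsometricMorphism_phiLim θ j).map_domain f hf⟩
    · exact (hle.2 h).trans ((isIsometricMorphism_phiLim θ j).map_dirac ξ).symm

/-- The difference of the two operators vanishes on `Γ_j` and is multiplication by `-(L - z)⁻¹` off
it, so its norm is controlled by the entries outside `Γ_j`. -/
theorem resolventsConverge_rotationTriple :
    ResolventsConverge (fun j => (rotationTriple θ j).dirac) (inclusionMapLim p)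
      (solenoidTriple θ).dirac := by
  intro z hz
  refine ⟨fun j => mulResolvent _ z hz, mulResolvent _ z hz,
    fun j => isResolventAt_mulResolvent _ z hz, isResolventAt_mulResolvent _ z hz, ?_⟩
  rw [Metric.tendsto_nhds]
  intro ε hε
  have hfin := (tendsto_inv_sub (solenoidLength p) (tendsto_solenoidLength p) z).norm.eventually
    (Iio_mem_nhds (show ‖(0 : ℂ)‖ < ε / 2 by simpa using hε))
  -- By properness only finitely many `γ` have an entry of size at least `ε / 2`; each lies in `Γ_j`
  -- eventually, hence so do all of them.
  filter_upwards [(Filter.eventually_all_finite (Filter.eventually_cofinite.1 hfin)).2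
    fun γ _ => eventually_mem_subgroupAt p γ] with j hj
  rw [dist_eq_norm]
  refine lt_of_le_of_lt (LTwo.opNorm_le_of_pointwise _ (half_pos hε).le fun f γ => ?_)
    (half_lt_self hε)
  rw [sub_apply, lp.coeFn_sub, Pi.sub_apply, mulResolvent_apply]
  by_cases hγ : γ ∈ subgroupAt p j
  · have h1 : (inclusionMapLim p j ∘L mulResolvent (fun γ : subgroupAt p j => solenoidLength p γ)
        z hz ∘L (inclusionMapLim p j).adjoint) f γ = ((solenoidLength p γ : ℂ) - z)⁻¹ * f γ := by
      refine (inclusionMapLim_apply j _ ⟨γ, hγ⟩).trans ((mulResolvent_apply _ z hz _ _).trans ?_)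
      exact congrArg _ (adjoint_inclusionMapLim_apply j f ⟨γ, hγ⟩)
    rw [h1, sub_self, norm_zero]
    positivity
  · have h1 : (inclusionMapLim p j ∘L mulResolvent (fun γ : subgroupAt p j => solenoidLength p γ)
        z hz ∘L (inclusionMapLim p j).adjoint) f γ = 0 :=
      inclusionMapLim_apply_of_notMem j _ hγ
    rw [h1, zero_sub, norm_neg, norm_mul]
    gcongr
    by_contra hlt
    exact hγ (hj γ fun h : ‖((solenoidLength p γ : ℂ) - z)⁻¹‖ < ε / 2 => hlt h.le)

end System

end NCSolenoid

theorem mainTheorem3 (p : ℕ) [Fact p.Prime] (θ : NCSolenoid.Omega p) :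
    NCSolenoid.IsInductiveSystem (NCSolenoid.rotationTriple θ) (NCSolenoid.phi θ)
      (NCSolenoid.inclusionMap p) ∧
    NCSolenoid.IsInductiveRealization (NCSolenoid.rotationTriple θ) (NCSolenoid.phi θ)
      (NCSolenoid.inclusionMap p) (NCSolenoid.solenoidTriple θ) (NCSolenoid.phiLim θ)
      (NCSolenoid.inclusionMapLim p) ∧
    NCSolenoid.ResolventsConverge (fun j => (NCSolenoid.rotationTriple θ j).dirac)
      (NCSolenoid.inclusionMapLim p) (NCSolenoid.solenoidTriple θ).dirac ∧
    NCSolenoid.CommutatorsUniformlyBounded (NCSolenoid.rotationTriple θ) (NCSolenoid.phi θ) ∧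
    (NCSolenoid.solenoidTriple θ).IsSpectralTriple :=
  ⟨NCSolenoid.isInductiveSystem_rotationTriple θ,
    NCSolenoid.isInductiveRealization_solenoidTriple θ,
    NCSolenoid.resolventsConverge_rotationTriple θ,
    NCSolenoid.commutatorsUniformlyBounded_rotationTriple θ,
    NCSolenoid.isSpectralTriple_solenoidTriple θ⟩
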